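/- Let $p\in L_\infty[0,1]$ be a real function with $p\ge c$ almost everywhere for some constant $c>0$, let $q$ and $r$ be real elements of $W_2^{-1}[0,1]$ (bounded linear functionals $f\mapsto\int_0^1 q f\,dx$, $f\mapsto\int_0^1 r f\,dx$ on the complex Sobolev space $W_2^1[0,1]$ that take real values on real functions), and let $U$ be a diagonal unitary complex $2\times2$ matrix. For $y\in W_2^1[0,1]$ put $y^{\wedge}=(y(0),y(1))^{T}$, and let $$\mathfrak H_U=\{y\in W_2^1[0,1] : y^{\wedge}\in\operatorname{im}(U-1)\},\qquad \|y\|_{\mathfrak H_U}^2=\int_0^1\{|y'|^2+|y|^2\}\,dx .$$ Let $I:\mathfrak H_U\to L_2[0,1]$ be the embedding, let $\mathfrak H_U'$ be the completion of $L_2[0,1]$ in the norm $\|f\|=\|I^*f\|_{\mathfrak H_U}$, and let $I^+:\mathfrak H'_U\to\mathfrak H_U$ be the isometry that extends $I^*$ continuously. Let $V$ be the diagonal $2\times2$ matrix with $V_{kk}=-\cot\frac{\arg U_{kk}}{2}$ if $U_{kk}\ne1$ and $V_{kk}=0$ if $U_{kk}=1$. Let $T(\lambda):\mathfrak H_U\to\mathfrak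 H'_U$, $\lambda\in\mathbb C$, be the linear pencil of bounded operators determined by $$\langle I^+T(\lambda)y,y\rangle_{\mathfrak H_U}=\int_0^1p\,|y'|^2\,dx+\int_0^1(q-\lambda r)\cdot|y|^2\,dx+\langle Vy^{\wedge},y^{\wedge}\rangle_{\mathbb C^2},\qquad y\in\mathfrak H_U .$$ The index of inertia $\operatorname{ind}E$ of a bounded Hermitian operator $E$ on a Hilbert space $\mathfrak H$ is the supremum of the dimensions of the subspaces $\mathfrak M\subseteq\mathfrak H$ for which there is $c>0$ with $\langle Ey,y\rangle\le-c\|y\|^2$ for all $y\in\mathfrak M$. Let $\lambda\in\mathbb R$ be an eigenvalue of the pencil $T$ and let $y\in\mathfrak H_U$ be a corresponding eigenfunction, that is, $y\ne0$ and $T(\lambda)y=0$. Then $\operatorname{ind}I^+T(\lambda)$ equals the number of zeros in the open interval $(0,1)$ of (the continuous representative of) $y$. -/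

import Mathlib

open MeasureTheory Set
open scoped ENNReal ComplexConjugate

noncomputable section

namespace SturmLiouville

/-- Lebesgue measure on `[0,1]`. -/
abbrev unitMeasure : Measure ℝ := volume.restrict (Icc (0 : ℝ) 1)

/-- The complex Hilbert space `L₂[0,1]`. -/
abbrev L2 : Type := Lp ℂ 2 unitMeasure

instance : IsProbabilityMeasure unitMeasure := ⟨by simp⟩

theorem L2.integrable (g : L2) : Integrable g unitMeasure :=
  (Lp.memLp g).integrable (by norm_num)

theorem L2.intervalIntegrable (g : L2) {a b : ℝ} (ha : a ∈ Icc (0 : ℝ) 1)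
    (hb : b ∈ Icc (0 : ℝ) 1) : IntervalIntegrable g volume a b := by
  have h : IntegrableOn g (Icc (0 : ℝ) 1) volume := g.integrable
  exact (h.mono_set (uIcc_subset_Icc ha hb)).intervalIntegrable

theorem L2.integral_norm_le (g : L2) : ∫ x, ‖g x‖ ∂unitMeasure ≤ ‖g‖ := by
  rw [integral_norm_eq_lintegral_enorm g.integrable.aestronglyMeasurable, Lp.norm_def]
  refine ENNReal.toReal_mono (Lp.memLp g).eLpNorm_ne_top ?_
  rw [← eLpNorm_one_eq_lintegral_enorm]
  exact eLpNorm_le_eLpNorm_of_exponent_le (by norm_num) g.integrable.aestronglyMeasurable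

theorem ae_mem : ∀ᵐ x ∂unitMeasure, x ∈ Icc (0 : ℝ) 1 :=
  ae_restrict_mem measurableSet_Icc

theorem L2.norm_primitive_le (g : L2) {x : ℝ} (hx : x ∈ Icc (0 : ℝ) 1) :
    ‖∫ t in (0 : ℝ)..x, g t‖ ≤ ‖g‖ := by
  refine (intervalIntegral.norm_integral_le_integral_norm hx.1).trans
    (le_trans ?_ g.integral_norm_le)
  rw [intervalIntegral.integral_of_le hx.1]
  exact setIntegral_mono_set g.integrable.norm
    (Filter.Eventually.of_forall fun _ => norm_nonneg _)
    (Filter.Eventually.of_forall fun t ht => ⟨ht.1.le, ht.2.trans hx.2⟩)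

theorem L2.continuousOn_primitive (g : L2) :
    ContinuousOn (fun x : ℝ => ∫ t in (0 : ℝ)..x, g t) (Icc 0 1) := by
  have h : IntegrableOn g (uIcc (0 : ℝ) 1) volume := by
    rw [uIcc_of_le zero_le_one]; exact g.integrable
  have := intervalIntegral.continuousOn_primitive_interval h
  rwa [uIcc_of_le zero_le_one] at this

theorem L2.primitive_add (g h : L2) {x : ℝ} (hx : x ∈ Icc (0 : ℝ) 1) :
    ∫ t in (0 : ℝ)..x, (g + h : L2) t =
      (∫ t in (0 : ℝ)..x, g t) + ∫ t in (0 : ℝ)..x, h t := by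
  have h0 : (0 : ℝ) ∈ Icc (0 : ℝ) 1 := by simp
  rw [← intervalIntegral.integral_add (g.intervalIntegrable h0 hx) (h.intervalIntegrable h0 hx),
    intervalIntegral.integral_of_le hx.1, intervalIntegral.integral_of_le hx.1]
  refine integral_congr_ae (ae_restrict_of_ae_restrict_of_subset (t := Icc (0 : ℝ) 1) ?_
    (Lp.coeFn_add g h))
  exact fun t ht => ⟨ht.1.le, ht.2.trans hx.2⟩

theorem L2.primitive_smul (a : ℂ) (g : L2) {x : ℝ} (hx : x ∈ Icc (0 : ℝ) 1) :
    ∫ t in (0 : ℝ)..x, (a • g : L2) t = a * ∫ t in (0 : ℝ)..x, g t := by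
  rw [← intervalIntegral.integral_const_mul,
    intervalIntegral.integral_of_le hx.1, intervalIntegral.integral_of_le hx.1]
  refine integral_congr_ae (ae_restrict_of_ae_restrict_of_subset (t := Icc (0 : ℝ) 1) ?_
    (Lp.coeFn_smul a g))
  exact fun t ht => ⟨ht.1.le, ht.2.trans hx.2⟩

/-- The Sobolev space `W₂¹[0,1]` of (classes of) absolutely continuous functions with derivative
in `L₂[0,1]`, as the space of pairs `(y, y')`.  The Hilbert norm that it inherits from
`L₂ ⊕ L₂` is `‖y‖² = ∫₀¹ (|y'|² + |y|²) dx`. -/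
def sobolev : Submodule ℂ (WithLp 2 (L2 × L2)) where
  carrier := {w | ∃ c : ℂ, ∀ᵐ x ∂unitMeasure, w.fst x = c + ∫ t in (0 : ℝ)..x, w.snd t}
  add_mem' := by
    rintro w z ⟨c, hc⟩ ⟨d, hd⟩
    refine ⟨c + d, ?_⟩
    filter_upwards [hc, hd, ae_mem, Lp.coeFn_add w.fst z.fst] with x h1 h2 hx h3
    rw [WithLp.add_fst, WithLp.add_snd, L2.primitive_add _ _ hx, h3, Pi.add_apply, h1, h2]
    ring
  zero_mem' := by
    refine ⟨0, ?_⟩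
    filter_upwards [ae_mem, Lp.coeFn_zero ℂ 2 unitMeasure] with x hx h
    have := L2.primitive_smul 0 0 hx
    rw [zero_smul, zero_mul] at this
    rw [WithLp.zero_fst, WithLp.zero_snd, this, h]
    simp
  smul_mem' := by
    rintro a w ⟨c, hc⟩
    refine ⟨a * c, ?_⟩
    filter_upwards [hc, ae_mem, Lp.coeFn_smul a w.fst] with x h1 hx h3
    rw [WithLp.smul_fst, WithLp.smul_snd, L2.primitive_smul _ _ hx, h3, Pi.smul_apply, h1]
    simp only [smul_eq_mul]
    ring

/-- The Hilbert space `W₂¹[0,1]` as a type. -/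
def W : Type := sobolev

instance : NormedAddCommGroup W := inferInstanceAs (NormedAddCommGroup sobolev)

instance : InnerProductSpace ℂ W := inferInstanceAs (InnerProductSpace ℂ sobolev)

/-- The isometric embedding `y ↦ (y, y')` of `W₂¹[0,1]` into `L₂ ⊕ L₂`. -/
def W.incl : W →ₗᵢ[ℂ] WithLp 2 (L2 × L2) := sobolev.subtypeₗᵢ

theorem W.coe_add (w z : W) : (w + z).1 = w.1 + z.1 := rfl

theorem W.coe_smul (a : ℂ) (w : W) : (a • w).1 = a • w.1 := rfl

theorem W.coe_sub (w z : W) : (w - z).1 = w.1 - z.1 := rfl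

/-- The derivative `y' ∈ L₂[0,1]` of `y ∈ W₂¹[0,1]`. -/
def W.deriv (w : W) : L2 := w.1.snd

/-- The initial value `y(0)` of the continuous representative. -/
def W.initial (w : W) : ℂ := w.2.choose

/-- The continuous representative of `y ∈ W₂¹[0,1]` (meaningful at `x ∈ [0,1]`). -/
def W.val (w : W) (x : ℝ) : ℂ := w.initial + ∫ t in (0 : ℝ)..x, w.deriv t

theorem W.val_ae (w : W) : ∀ᵐ x ∂unitMeasure, w.1.fst x = w.val x := w.2.choose_spec

theorem W.continuousOn_val (w : W) : ContinuousOn w.val (Icc 0 1) :=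
  continuousOn_const.add (L2.continuousOn_primitive _)

theorem W.initial_eq (w : W) {c : ℂ}
    (hc : ∀ᵐ x ∂unitMeasure, w.1.fst x = c + ∫ t in (0 : ℝ)..x, w.1.snd t) : w.initial = c := by
  obtain ⟨x, h1, h2⟩ := (hc.and w.val_ae).exists
  exact add_right_cancel (h2.symm.trans h1)

theorem W.initial_add (w z : W) : (w + z).initial = w.initial + z.initial := by
  refine W.initial_eq _ ?_
  filter_upwards [w.val_ae, z.val_ae, ae_mem, Lp.coeFn_add w.1.fst z.1.fst] with x h1 h2 hx h3
  rw [W.coe_add, WithLp.add_fst, WithLp.add_snd, L2.primitive_add _ _ hx, h3,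
    Pi.add_apply, h1, h2]
  simp only [W.val, W.deriv]
  ring

theorem W.initial_smul (a : ℂ) (w : W) : (a • w).initial = a * w.initial := by
  refine W.initial_eq _ ?_
  filter_upwards [w.val_ae, ae_mem, Lp.coeFn_smul a w.1.fst] with x h1 hx h3
  rw [W.coe_smul, WithLp.smul_fst, WithLp.smul_snd, L2.primitive_smul _ _ hx, h3,
    Pi.smul_apply, h1]
  simp only [W.val, W.deriv, smul_eq_mul]
  ring

theorem W.deriv_add (w z : W) : (w + z).deriv = w.deriv + z.deriv := rfl

theorem W.deriv_smul (a : ℂ) (w : W) : (a • w).deriv = a • w.deriv := rfl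

theorem W.val_add (w z : W) {x : ℝ} (hx : x ∈ Icc (0 : ℝ) 1) :
    (w + z).val x = w.val x + z.val x := by
  simp only [W.val, W.initial_add, W.deriv_add, L2.primitive_add _ _ hx]
  ring

theorem W.val_smul (a : ℂ) (w : W) {x : ℝ} (hx : x ∈ Icc (0 : ℝ) 1) :
    (a • w).val x = a * w.val x := by
  simp only [W.val, W.initial_smul, W.deriv_smul, L2.primitive_smul _ _ hx]
  ring

theorem W.norm_fst_le (w : W) : ‖w.1.fst‖ ≤ ‖w‖ := WithLp.norm_fst_le _ w.1

theorem W.norm_deriv_le (w : W) : ‖w.deriv‖ ≤ ‖w‖ := WithLp.norm_snd_le _ w.1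

theorem W.norm_initial_le (w : W) : ‖w.initial‖ ≤ 2 * ‖w‖ := by
  have h : ∀ᵐ x ∂unitMeasure, ‖w.initial‖ ≤ ‖w.1.fst x‖ + ‖w.deriv‖ := by
    filter_upwards [w.val_ae, ae_mem] with x h1 hx
    have : w.initial = w.1.fst x - ∫ t in (0 : ℝ)..x, w.deriv t := by
      rw [h1, W.val]; ring
    rw [this]
    exact (norm_sub_le _ _).trans (add_le_add le_rfl (w.deriv.norm_primitive_le hx))
  have := integral_mono_ae (integrable_const _)
    ((L2.integrable w.1.fst).norm.add (integrable_const _)) h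
  rw [integral_add' (L2.integrable w.1.fst).norm (integrable_const _)] at this
  simp only [integral_const, probReal_univ, one_smul] at this
  linarith [L2.integral_norm_le w.1.fst, w.norm_fst_le, w.norm_deriv_le]

theorem W.norm_val_le (w : W) {x : ℝ} (hx : x ∈ Icc (0 : ℝ) 1) : ‖w.val x‖ ≤ 3 * ‖w‖ := by
  have := norm_add_le w.initial (∫ t in (0 : ℝ)..x, w.deriv t)
  rw [W.val]
  linarith [w.norm_initial_le, w.norm_deriv_le, w.deriv.norm_primitive_le hx]

/-! Completeness of `W₂¹[0,1]`. -/

theorem L2.memLp_primitive (g : L2) :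
    MemLp (fun x : ℝ => ∫ t in (0 : ℝ)..x, g t) 2 unitMeasure := by
  refine MemLp.of_bound (g.continuousOn_primitive.aestronglyMeasurable measurableSet_Icc) ‖g‖ ?_
  filter_upwards [ae_mem] with x hx using g.norm_primitive_le hx

/-- The Volterra operator `g ↦ ∫₀ˣ g`. -/
def volterra : L2 →L[ℂ] L2 :=
  LinearMap.mkContinuous
    { toFun := fun g => g.memLp_primitive.toLp _
      map_add' := fun g h => by
        rw [← MemLp.toLp_add]
        refine MemLp.toLp_congr _ _ ?_
        filter_upwards [ae_mem] with x hx using L2.primitive_add g h hx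
      map_smul' := fun a g => by
        rw [RingHom.id_apply, ← MemLp.toLp_const_smul]
        refine MemLp.toLp_congr _ _ ?_
        filter_upwards [ae_mem] with x hx using L2.primitive_smul a g hx }
    1 (fun g => by
      have h := Lp.norm_le_of_ae_bound (f := g.memLp_primitive.toLp _) (norm_nonneg g) (by
        filter_upwards [ae_mem, g.memLp_primitive.coeFn_toLp] with x hx h
        rw [h]
        exact g.norm_primitive_le hx)
      have hμ : measureUnivNNReal unitMeasure = 1 := by
        simp [measureUnivNNReal]
      simpa [hμ] using h)

theorem volterra_ae (g : L2) : ∀ᵐ x ∂unitMeasure, volterra g x = ∫ t in (0 : ℝ)..x, g t :=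
  g.memLp_primitive.coeFn_toLp

theorem isClosed_sobolev : IsClosed (sobolev : Set (WithLp 2 (L2 × L2))) := by
  let one : L2 := (memLp_const (1 : ℂ)).toLp _
  have h1 : ∀ c : ℂ, ∀ᵐ x ∂unitMeasure, (c • one : L2) x = c := fun c => by
    filter_upwards [Lp.coeFn_smul c one, (memLp_const (1 : ℂ)).coeFn_toLp (p := 2)
      (μ := unitMeasure)] with x h h'
    rw [h, Pi.smul_apply, h']
    simp
  have h : (sobolev : Set (WithLp 2 (L2 × L2))) =
      (fun w : WithLp 2 (L2 × L2) => w.fst - volterra w.snd) ⁻¹'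
        (Submodule.span ℂ {one} : Set L2) := by
    ext w
    simp only [mem_preimage, SetLike.mem_coe, Submodule.mem_span_singleton]
    refine exists_congr fun c => ?_
    constructor
    · intro hc
      refine Lp.ext ?_
      filter_upwards [hc, h1 c, volterra_ae w.snd, Lp.coeFn_sub w.fst (volterra w.snd)]
        with x a b d e
      rw [b, e, Pi.sub_apply, a, d]; ring
    · intro hc
      filter_upwards [h1 c, volterra_ae w.snd, Lp.coeFn_sub w.fst (volterra w.snd)] with x b d e
      rw [hc, e, Pi.sub_apply, d] at b
      rw [← b]; ring
  rw [h]
  refine (Submodule.closed_of_finiteDimensional _).preimage ?_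
  exact (WithLp.prod_continuous_ofLp _ _ _).fst.sub
    (volterra.continuous.comp (WithLp.prod_continuous_ofLp _ _ _).snd)

instance : CompleteSpace W := isClosed_sobolev.completeSpace_coe

theorem W.eq_zero_of_fst_eq_zero (w : W) (h : w.1.fst = 0) : w = 0 := by
  have hz : ∀ᵐ x ∂unitMeasure, w.val x = 0 := by
    filter_upwards [w.val_ae, Lp.coeFn_zero ℂ 2 unitMeasure] with x h1 h2
    rw [← h1, h, h2]; rfl
  have hz' : EqOn w.val (fun _ => 0) (Icc 0 1) :=
    Measure.eqOn_Icc_of_ae_eq volume zero_ne_one hz w.continuousOn_val continuousOn_const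
  have hd := (w.deriv.intervalIntegrable (a := 0) (b := 1) (by simp) (by simp)).ae_hasDerivAt_integral
  have hw : w.deriv = 0 := by
    refine Lp.ext ?_
    have hI : ∀ᵐ x ∂unitMeasure, x ∈ Ioo (0 : ℝ) 1 := by
      rw [unitMeasure, Measure.restrict_congr_set Ioo_ae_eq_Icc.symm]
      exact ae_restrict_mem measurableSet_Ioo
    filter_upwards [hI, ae_restrict_of_ae hd, Lp.coeFn_zero ℂ 2 unitMeasure] with x hx h1 h2
    rw [h2]
    have h3 := h1 (by rw [uIcc_of_le zero_le_one]; exact ⟨hx.1.le, hx.2.le⟩) 0 (by simp)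
    have h4 : HasDerivAt (fun y => ∫ t in (0 : ℝ)..y, w.deriv t) 0 x := by
      refine (hasDerivAt_const x (-w.initial)).congr_of_eventuallyEq ?_
      filter_upwards [Icc_mem_nhds hx.1 hx.2] with y hy
      have := hz' hy
      rw [W.val] at this
      exact (neg_eq_of_add_eq_zero_right this).symm
    exact h3.unique h4
  exact Subtype.ext ((WithLp.ofLp_injective _) (Prod.ext h hw))

/-! The product `y z̄ ∈ W₂¹[0,1]` of `y, z ∈ W₂¹[0,1]`. -/

theorem integral_mul_integral {f g : ℝ → ℂ} {x : ℝ} (hx : 0 ≤ x)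
    (hf : IntegrableOn f (Ioc 0 x)) (hg : IntegrableOn g (Ioc 0 x)) :
    (∫ t in (0 : ℝ)..x, f t) * (∫ t in (0 : ℝ)..x, g t) =
      (∫ s in (0 : ℝ)..x, f s * ∫ t in (0 : ℝ)..s, g t) +
        ∫ s in (0 : ℝ)..x, (∫ t in (0 : ℝ)..s, f t) * g s := by
  set ν : Measure ℝ := volume.restrict (Ioc 0 x) with hν
  have hfg : Integrable (fun z : ℝ × ℝ => f z.1 * g z.2) (ν.prod ν) := hf.mul_prod hg
  have hS : MeasurableSet {z : ℝ × ℝ | z.2 ≤ z.1} := measurableSet_le measurable_snd measurable_fst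
  have hm : ∀ᵐ s ∂ν, s ∈ Ioc 0 x := ae_restrict_mem measurableSet_Ioc
  have key : ∀ (h : ℝ → ℂ) (s : ℝ), s ∈ Ioc 0 x →
      ∫ t in Iic s, h t ∂ν = ∫ t in (0 : ℝ)..s, h t := by
    intro h s hs
    rw [intervalIntegral.integral_of_le hs.1.le, hν, Measure.restrict_restrict measurableSet_Iic]
    congr 2
    ext t
    simp only [mem_inter_iff, mem_Iic, mem_Ioc]
    exact ⟨fun h => ⟨h.2.1, h.1⟩, fun h => ⟨h.2, h.1, h.2.trans hs.2⟩⟩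
  have hA : ∫ z in {z : ℝ × ℝ | z.2 ≤ z.1}, f z.1 * g z.2 ∂(ν.prod ν) =
      ∫ s, f s * (∫ t in (0 : ℝ)..s, g t) ∂ν := by
    rw [← integral_indicator hS, integral_prod _ (hfg.indicator hS)]
    refine integral_congr_ae ?_
    filter_upwards [hm] with s hs
    rw [← key g s hs, ← integral_const_mul, ← integral_indicator measurableSet_Iic]
    rfl
  have hB : ∫ z in {z : ℝ × ℝ | z.2 ≤ z.1}ᶜ, f z.1 * g z.2 ∂(ν.prod ν) =
      ∫ s, (∫ t in (0 : ℝ)..s, f t) * g s ∂ν := by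
    rw [← integral_indicator hS.compl, integral_prod_symm _ (hfg.indicator hS.compl)]
    refine integral_congr_ae ?_
    filter_upwards [hm] with s hs
    have hae : (Iic s : Set ℝ) =ᵐ[ν] Iio s := Iio_ae_eq_Iic.symm
    rw [← key f s hs, ← integral_mul_const, setIntegral_congr_set hae,
      ← integral_indicator measurableSet_Iio]
    refine integral_congr_ae (Filter.Eventually.of_forall fun t => ?_)
    simp [indicator, not_le]
  rw [intervalIntegral.integral_of_le hx, intervalIntegral.integral_of_le hx,
    intervalIntegral.integral_of_le hx, intervalIntegral.integral_of_le hx, ← hν]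
  exact (integral_prod_mul f g).symm.trans
    ((integral_add_compl hS hfg).symm.trans (congrArg₂ _ hA hB))

theorem L2.memLp_mul (g : L2) {u : ℝ → ℂ} (hu : ContinuousOn u (Icc 0 1)) :
    MemLp (fun x => u x * g x) 2 unitMeasure := by
  obtain ⟨C, hC⟩ := isCompact_Icc.exists_bound_of_continuousOn hu
  refine (Lp.memLp g).of_le_mul (c := C)
    ((hu.aestronglyMeasurable measurableSet_Icc).mul (Lp.memLp g).aestronglyMeasurable) ?_
  filter_upwards [ae_mem] with x hx
  rw [norm_mul]
  exact mul_le_mul_of_nonneg_right (hC x hx) (norm_nonneg _)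

theorem W.continuousOn_conj_val (z : W) : ContinuousOn (fun x => conj (z.val x)) (Icc 0 1) :=
  Complex.continuous_conj.comp_continuousOn z.continuousOn_val

theorem L2.memLp_conj (g : L2) : MemLp (fun x => conj (g x)) 2 unitMeasure := (Lp.memLp g).star

/-- The conjugate of an element of `L₂[0,1]`. -/
def L2.conj (g : L2) : L2 := g.memLp_conj.toLp _

/-- The product of an element of `L₂[0,1]` by a function continuous on `[0,1]`. -/
def L2.cmul (u : ℝ → ℂ) (hu : ContinuousOn u (Icc 0 1)) (g : L2) : L2 := (g.memLp_mul hu).toLp _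

theorem L2.conj_ae (g : L2) : ∀ᵐ x ∂unitMeasure, g.conj x = starRingEnd ℂ (g x) :=
  g.memLp_conj.coeFn_toLp

theorem L2.cmul_ae (u : ℝ → ℂ) (hu : ContinuousOn u (Icc 0 1)) (g : L2) :
    ∀ᵐ x ∂unitMeasure, L2.cmul u hu g x = u x * g x := (g.memLp_mul hu).coeFn_toLp

theorem L2.norm_conj_le (g : L2) : ‖g.conj‖ ≤ ‖g‖ := by
  refine Lp.norm_le_norm_of_ae_le ?_
  filter_upwards [g.conj_ae] with x hx
  rw [hx, RCLike.norm_conj]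

theorem L2.norm_cmul_le {u : ℝ → ℂ} (hu : ContinuousOn u (Icc 0 1)) (g : L2) {C : ℝ}
    (hC : ∀ x ∈ Icc (0 : ℝ) 1, ‖u x‖ ≤ C) : ‖L2.cmul u hu g‖ ≤ C * ‖g‖ := by
  refine Lp.norm_le_mul_norm_of_ae_le_mul ?_
  filter_upwards [L2.cmul_ae u hu g, ae_mem] with x hx hx'
  rw [hx, norm_mul]
  exact mul_le_mul_of_nonneg_right (hC x hx') (norm_nonneg _)

theorem ae_interval {P : ℝ → Prop} (h : ∀ᵐ x ∂unitMeasure, P x) {x : ℝ}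
    (hx : x ∈ Icc (0 : ℝ) 1) : ∀ᵐ t ∂volume.restrict (Ioc 0 x), P t :=
  ae_restrict_of_ae_restrict_of_subset (t := Icc (0 : ℝ) 1)
    (fun _ ht => ⟨ht.1.le, ht.2.trans hx.2⟩) h

theorem L2.integrableOn (g : L2) {x : ℝ} (hx : x ∈ Icc (0 : ℝ) 1) : IntegrableOn g (Ioc 0 x) :=
  IntegrableOn.mono_set (t := Icc (0 : ℝ) 1) g.integrable
    (fun _ ht => ⟨ht.1.le, ht.2.trans hx.2⟩)

theorem L2.primitive_conj (g : L2) {x : ℝ} (hx : x ∈ Icc (0 : ℝ) 1) :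
    ∫ t in (0 : ℝ)..x, g.conj t = starRingEnd ℂ (∫ t in (0 : ℝ)..x, g t) := by
  rw [intervalIntegral.integral_of_le hx.1, intervalIntegral.integral_of_le hx.1, ← integral_conj]
  exact integral_congr_ae (ae_interval g.conj_ae hx)

/-- The derivative `y' z̄ + y z̄'` of `y z̄`. -/
def W.derivMulConj (y z : W) : L2 :=
  L2.cmul _ z.continuousOn_conj_val y.deriv + L2.cmul _ y.continuousOn_val z.deriv.conj

theorem W.val_mul_conj (y z : W) {x : ℝ} (hx : x ∈ Icc (0 : ℝ) 1) :
    y.val x * conj (z.val x) =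
      y.initial * conj z.initial + ∫ t in (0 : ℝ)..x, y.derivMulConj z t := by
  have h0 : (0 : ℝ) ∈ Icc (0 : ℝ) 1 := by simp
  have e1 : ∫ t in (0 : ℝ)..x, y.derivMulConj z t =
      ∫ t in (0 : ℝ)..x, ((conj z.initial * y.deriv t + y.initial * z.deriv.conj t) +
        (y.deriv t * (∫ s in (0 : ℝ)..t, z.deriv.conj s) +
          (∫ s in (0 : ℝ)..t, y.deriv s) * z.deriv.conj t)) := by
    rw [intervalIntegral.integral_of_le hx.1, intervalIntegral.integral_of_le hx.1]
    refine integral_congr_ae (ae_interval (x := x) ?_ hx)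
    filter_upwards [Lp.coeFn_add (L2.cmul _ z.continuousOn_conj_val y.deriv)
      (L2.cmul _ y.continuousOn_val z.deriv.conj), L2.cmul_ae _ z.continuousOn_conj_val y.deriv,
      L2.cmul_ae _ y.continuousOn_val z.deriv.conj, ae_mem] with t h1 h2 h3 ht
    rw [W.derivMulConj, h1, Pi.add_apply, h2, h3, L2.primitive_conj _ ht, W.val, W.val, map_add]
    ring
  have i1 := (y.deriv.intervalIntegrable h0 hx).const_mul (conj z.initial)
  have i2 := (z.deriv.conj.intervalIntegrable h0 hx).const_mul y.initial
  have i3 : IntervalIntegrable (fun t => y.deriv t * ∫ s in (0 : ℝ)..t, z.deriv.conj s)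
      volume 0 x := by
    refine (y.deriv.intervalIntegrable h0 hx).mul_continuousOn ?_
    exact z.deriv.conj.continuousOn_primitive.mono (uIcc_subset_Icc h0 hx)
  have i4 : IntervalIntegrable (fun t => (∫ s in (0 : ℝ)..t, y.deriv s) * z.deriv.conj t)
      volume 0 x := by
    refine (z.deriv.conj.intervalIntegrable h0 hx).continuousOn_mul ?_
    exact y.deriv.continuousOn_primitive.mono (uIcc_subset_Icc h0 hx)
  rw [e1, intervalIntegral.integral_add (i1.add i2) (i3.add i4),
    intervalIntegral.integral_add i1 i2, intervalIntegral.integral_add i3 i4,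
    ← integral_mul_integral hx.1 (y.deriv.integrableOn hx) (z.deriv.conj.integrableOn hx),
    intervalIntegral.integral_const_mul, intervalIntegral.integral_const_mul,
    L2.primitive_conj _ hx, W.val, W.val, map_add]
  ring

theorem W.memLp_val (w : W) : MemLp w.val 2 unitMeasure := by
  refine MemLp.of_bound (w.continuousOn_val.aestronglyMeasurable measurableSet_Icc) (3 * ‖w‖) ?_
  filter_upwards [ae_mem] with x hx using w.norm_val_le hx

/-- The element `y z̄` of `W₂¹[0,1]`, for `y, z ∈ W₂¹[0,1]`. -/
def W.mulConj (y z : W) : W :=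
  ⟨WithLp.toLp 2 (L2.cmul _ y.continuousOn_val (L2.conj z.1.fst), y.derivMulConj z),
    y.initial * conj z.initial, by
      filter_upwards [L2.cmul_ae _ y.continuousOn_val (L2.conj z.1.fst), L2.conj_ae z.1.fst,
        z.val_ae, ae_mem] with x h1 h2 h3 hx
      change L2.cmul _ y.continuousOn_val (L2.conj z.1.fst) x = _
      rw [h1, h2, h3, W.val_mul_conj y z hx]
      rfl⟩

theorem W.val_mulConj (y z : W) {x : ℝ} (hx : x ∈ Icc (0 : ℝ) 1) :
    (y.mulConj z).val x = y.val x * conj (z.val x) := by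
  have h : (y.mulConj z).initial = y.initial * conj z.initial := by
    refine W.initial_eq _ ?_
    filter_upwards [L2.cmul_ae _ y.continuousOn_val (L2.conj z.1.fst), L2.conj_ae z.1.fst,
        z.val_ae, ae_mem] with x h1 h2 h3 hx
    change L2.cmul _ y.continuousOn_val (L2.conj z.1.fst) x = _
    rw [h1, h2, h3, W.val_mul_conj y z hx]
    rfl
  rw [W.val_mul_conj y z hx, W.val, h]
  rfl

theorem W.ext_val {w z : W} (h : ∀ x ∈ Icc (0 : ℝ) 1, w.val x = z.val x) : w = z := by
  have hf : w.1.fst = z.1.fst := by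
    refine Lp.ext ?_
    filter_upwards [w.val_ae, z.val_ae, ae_mem] with x h1 h2 hx
    rw [h1, h2, h x hx]
  refine sub_eq_zero.1 (W.eq_zero_of_fst_eq_zero _ ?_)
  rw [W.coe_sub, WithLp.sub_fst, hf, sub_self]

theorem W.norm_mulConj_le (y z : W) : ‖y.mulConj z‖ ≤ 9 * ‖y‖ * ‖z‖ := by
  have h1 : ‖(y.mulConj z).1.fst‖ ≤ 3 * ‖y‖ * ‖z‖ := by
    refine (L2.norm_cmul_le y.continuousOn_val _ fun x hx => y.norm_val_le hx).trans ?_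
    exact mul_le_mul_of_nonneg_left ((L2.norm_conj_le _).trans z.norm_fst_le) (by positivity)
  have h2 : ‖(y.mulConj z).1.snd‖ ≤ 3 * ‖z‖ * ‖y‖ + 3 * ‖y‖ * ‖z‖ := by
    refine (norm_add_le _ _).trans (add_le_add ?_ ?_)
    · refine (L2.norm_cmul_le z.continuousOn_conj_val _ (C := 3 * ‖z‖) fun x hx => ?_).trans ?_
      · rw [RCLike.norm_conj]; exact z.norm_val_le hx
      · exact mul_le_mul_of_nonneg_left y.norm_deriv_le (by positivity)
    · refine (L2.norm_cmul_le y.continuousOn_val _ fun x hx => y.norm_val_le hx).trans ?_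
      exact mul_le_mul_of_nonneg_left ((L2.norm_conj_le _).trans z.norm_deriv_le) (by positivity)
  have h3 : ‖y.mulConj z‖ ≤ ‖(y.mulConj z).1.fst‖ + ‖(y.mulConj z).1.snd‖ := by
    have h4 : ‖y.mulConj z‖ ^ 2 = ‖(y.mulConj z).1.fst‖ ^ 2 + ‖(y.mulConj z).1.snd‖ ^ 2 :=
      WithLp.prod_norm_sq_eq_of_L2 (y.mulConj z).1
    refine abs_le_of_sq_le_sq' ?_ (by positivity) |>.2
    nlinarith [mul_nonneg (norm_nonneg (y.mulConj z).1.fst) (norm_nonneg (y.mulConj z).1.snd)]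
  linarith

/-! The operator pencil. -/

/-- The vector `y^∧ = (y(0), y(1))`. -/
def trace : W →L[ℂ] (Fin 2 → ℂ) :=
  LinearMap.mkContinuous
    { toFun := fun y => ![y.val 0, y.val 1]
      map_add' := fun y z => by simp [W.val_add]
      map_smul' := fun a y => by simp [W.val_smul] }
    3 (fun y => by
      refine (pi_norm_le_iff_of_nonneg (by positivity)).2 fun i => ?_
      fin_cases i
      · exact y.norm_val_le (by simp)
      · exact y.norm_val_le (by simp))

/-- The space `ℌ_U = {y ∈ W₂¹[0,1] | y^∧ ∈ im (U - 1)}`. -/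
def HU (U : Matrix (Fin 2) (Fin 2) ℂ) : Submodule ℂ W :=
  (LinearMap.range (U - 1).mulVecLin).comap trace.toLinearMap

theorem isClosed_HU (U : Matrix (Fin 2) (Fin 2) ℂ) : IsClosed (HU U : Set W) :=
  (Submodule.closed_of_finiteDimensional (LinearMap.range (U - 1).mulVecLin)).preimage
    trace.continuous

instance (U : Matrix (Fin 2) (Fin 2) ℂ) : CompleteSpace (HU U) := (isClosed_HU U).completeSpace_coe

/-- The embedding `I : ℌ_U → L₂[0,1]`. -/
def embed (U : Matrix (Fin 2) (Fin 2) ℂ) : HU U →L[ℂ] L2 :=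
  (WithLp.fstL 2 ℂ L2 L2 ∘L W.incl.toContinuousLinearMap) ∘L (HU U).subtypeL

/-- `L₂[0,1]` with the norm `‖I* f‖`. -/
def PreNeg (_U : Matrix (Fin 2) (Fin 2) ℂ) : Type := L2

instance (U : Matrix (Fin 2) (Fin 2) ℂ) : AddCommGroup (PreNeg U) :=
  inferInstanceAs (AddCommGroup L2)

instance (U : Matrix (Fin 2) (Fin 2) ℂ) : Module ℂ (PreNeg U) :=
  inferInstanceAs (Module ℂ L2)

/-- The operator `I* : L₂[0,1] → ℌ_U`. -/
def adj (U : Matrix (Fin 2) (Fin 2) ℂ) : PreNeg U →ₗ[ℂ] HU U :=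
  (ContinuousLinearMap.adjoint (embed U)).toLinearMap

instance (U : Matrix (Fin 2) (Fin 2) ℂ) : SeminormedAddCommGroup (PreNeg U) :=
  SeminormedAddCommGroup.induced (PreNeg U) (HU U) (adj U)

instance (U : Matrix (Fin 2) (Fin 2) ℂ) : NormedSpace ℂ (PreNeg U) :=
  NormedSpace.induced ℂ (PreNeg U) (HU U) (adj U)

/-- The space `ℌ'_U`, the completion of `L₂[0,1]` with respect to the norm `‖I* f‖`. -/
abbrev HNeg (U : Matrix (Fin 2) (Fin 2) ℂ) : Type := UniformSpace.Completion (PreNeg U)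

/-- `I*` as an isometry for the norm `‖I* f‖`. -/
def adjIsometry (U : Matrix (Fin 2) (Fin 2) ℂ) : PreNeg U →ₗᵢ[ℂ] HU U := ⟨adj U, fun _ => rfl⟩

theorem embed_injective (U : Matrix (Fin 2) (Fin 2) ℂ) : Function.Injective (embed U) := by
  refine (injective_iff_map_eq_zero _).2 fun y hy => ?_
  exact Subtype.ext (W.eq_zero_of_fst_eq_zero _ hy)

theorem denseRange_adjIsometry (U : Matrix (Fin 2) (Fin 2) ℂ) :
    DenseRange (adjIsometry U) := by
  have h : (ContinuousLinearMap.adjoint (embed U)).rangeᗮ = ⊥ := by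
    rw [ContinuousLinearMap.orthogonal_range, ContinuousLinearMap.adjoint_adjoint]
    exact LinearMap.ker_eq_bot.2 (embed_injective U)
  have h2 := (Submodule.topologicalClosure_eq_top_iff).2 h
  intro y
  have : y ∈ (ContinuousLinearMap.adjoint (embed U)).range.topologicalClosure := by
    rw [h2]; trivial
  exact this

/-- The continuous extension of `I*` to `ℌ'_U`. -/
def extAdj (U : Matrix (Fin 2) (Fin 2) ℂ) : HNeg U →L[ℂ] HU U :=
  (adjIsometry U).toContinuousLinearMap.extend
    (UniformSpace.Completion.toComplL : PreNeg U →L[ℂ] HNeg U)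

theorem extAdj_coe (U : Matrix (Fin 2) (Fin 2) ℂ) (f : PreNeg U) :
    extAdj U (f : HNeg U) = adjIsometry U f :=
  ContinuousLinearMap.extend_eq (e := (UniformSpace.Completion.toComplL : PreNeg U →L[ℂ] HNeg U)) _
    UniformSpace.Completion.denseRange_coe (UniformSpace.Completion.isUniformInducing_coe _) f

theorem norm_extAdj (U : Matrix (Fin 2) (Fin 2) ℂ) (f : HNeg U) : ‖extAdj U f‖ = ‖f‖ := by
  refine UniformSpace.Completion.induction_on f
    (isClosed_eq (extAdj U).continuous.norm continuous_norm) fun g => ?_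
  rw [extAdj_coe, LinearIsometry.norm_map, UniformSpace.Completion.norm_coe]

/-- `I⁺` as a linear isometry. -/
def plusIsometry (U : Matrix (Fin 2) (Fin 2) ℂ) : HNeg U →ₗᵢ[ℂ] HU U :=
  ⟨(extAdj U).toLinearMap, norm_extAdj U⟩

theorem plusIsometry_surjective (U : Matrix (Fin 2) (Fin 2) ℂ) :
    Function.Surjective (plusIsometry U) := by
  have h1 : IsClosed (range (plusIsometry U)) :=
    (plusIsometry U).isometry.isClosedEmbedding.isClosed_range
  have h2 : range (adjIsometry U) ⊆ range (plusIsometry U) := by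
    rintro _ ⟨f, rfl⟩
    exact ⟨f, extAdj_coe U f⟩
  exact range_eq_univ.1 (h1.closure_eq ▸ ((denseRange_adjIsometry U).mono h2).closure_eq)

/-- The isometry `I⁺ : ℌ'_U → ℌ_U` that extends `I*`; it is onto because `I` is injective. -/
def Iplus (U : Matrix (Fin 2) (Fin 2) ℂ) : HNeg U ≃ₗᵢ[ℂ] HU U :=
  LinearIsometryEquiv.ofSurjective (plusIsometry U) (plusIsometry_surjective U)

/-- The space `W₂⁻¹[0,1]`: bounded linear functionals `y ↦ ∫₀¹ q y dx` on `W₂¹[0,1]`. -/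
abbrev WNeg : Type := W →L[ℂ] ℂ

/-- An element of `W₂⁻¹[0,1]` is real if it is real on real functions. -/
def WNeg.IsReal (q : WNeg) : Prop :=
  ∀ y : W, (∀ x ∈ Icc (0 : ℝ) 1, (y.val x).im = 0) → (q y).im = 0

/-- The diagonal matrix `V` with `V_kk = -cot (arg U_kk / 2)` if `U_kk ≠ 1`, and `0` otherwise. -/
def boundaryMatrix (U : Matrix (Fin 2) (Fin 2) ℂ) : Matrix (Fin 2) (Fin 2) ℂ :=
  open scoped Classical in
  Matrix.diagonal fun k => if U k k = 1 then 0 else ((-Real.cot (Complex.arg (U k k) / 2) : ℝ) : ℂ)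

/-- The sesquilinear form (linear in `y`, antilinear in `z`)
`∫ p y' z̄' dx + ∫ (q - λ r) y z̄ dx + ⟨V y^∧, z^∧⟩`. -/
def form (p : Lp ℝ ∞ unitMeasure) (q r : WNeg) (U : Matrix (Fin 2) (Fin 2) ℂ) (lam : ℂ)
    (y z : W) : ℂ :=
  (∫ x, (p x : ℂ) * y.deriv x * conj (z.deriv x) ∂unitMeasure) +
    (q - lam • r) (y.mulConj z) + (boundaryMatrix U).mulVec (trace y) ⬝ᵥ star (trace z)

theorem integral_eq_inner (p : Lp ℝ ∞ unitMeasure) (f g : L2) :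
    ∫ x, (p x : ℂ) * f x * conj (g x) ∂unitMeasure = inner ℂ g (p • f : L2) := by
  rw [L2.inner_def]
  refine integral_congr_ae ?_
  filter_upwards [Lp.coeFn_lpSMul (r := 2) p f] with x hx
  rw [hx]
  simp [RCLike.inner_apply]

theorem form_add_left (p : Lp ℝ ∞ unitMeasure) (q r : WNeg) (U : Matrix (Fin 2) (Fin 2) ℂ)
    (lam : ℂ) (y₁ y₂ z : W) :
    form p q r U lam (y₁ + y₂) z = form p q r U lam y₁ z + form p q r U lam y₂ z := by
  have h : (y₁ + y₂).mulConj z = y₁.mulConj z + y₂.mulConj z := W.ext_val fun x hx => by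
    rw [W.val_add _ _ hx, W.val_mulConj _ _ hx, W.val_mulConj _ _ hx, W.val_mulConj _ _ hx,
      W.val_add _ _ hx, add_mul]
  simp only [form, integral_eq_inner, W.deriv_add, Lp.add_smul, inner_add_right, h, map_add,
    Matrix.mulVec_add, add_dotProduct]
  ring

theorem form_smul_left (p : Lp ℝ ∞ unitMeasure) (q r : WNeg) (U : Matrix (Fin 2) (Fin 2) ℂ)
    (lam a : ℂ) (y z : W) :
    form p q r U lam (a • y) z = a * form p q r U lam y z := by
  have h : (a • y).mulConj z = a • y.mulConj z := W.ext_val fun x hx => by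
    rw [W.val_smul _ _ hx, W.val_mulConj _ _ hx, W.val_mulConj _ _ hx, W.val_smul _ _ hx,
      mul_assoc]
  have h2 : (p • (a • y.deriv : L2) : L2) = (a • (p • y.deriv : L2) : L2) := by
    refine Lp.ext ?_
    filter_upwards [Lp.coeFn_lpSMul (r := 2) p (a • y.deriv), Lp.coeFn_smul a y.deriv,
      Lp.coeFn_lpSMul (r := 2) p y.deriv, Lp.coeFn_smul a (p • y.deriv : L2)] with x h1 h2 h3 h4
    rw [h1, h4, Pi.smul_apply', h2, Pi.smul_apply, Pi.smul_apply, h3, Pi.smul_apply',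
      smul_comm]
  simp only [form, integral_eq_inner, W.deriv_smul, h2, inner_smul_right, h, map_smul,
    Matrix.mulVec_smul, smul_dotProduct, smul_eq_mul]
  ring

theorem form_add_right (p : Lp ℝ ∞ unitMeasure) (q r : WNeg) (U : Matrix (Fin 2) (Fin 2) ℂ)
    (lam : ℂ) (y z₁ z₂ : W) :
    form p q r U lam y (z₁ + z₂) = form p q r U lam y z₁ + form p q r U lam y z₂ := by
  have h : y.mulConj (z₁ + z₂) = y.mulConj z₁ + y.mulConj z₂ := W.ext_val fun x hx => by
    rw [W.val_add _ _ hx, W.val_mulConj _ _ hx, W.val_mulConj _ _ hx, W.val_mulConj _ _ hx,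
      W.val_add _ _ hx, map_add, mul_add]
  simp only [form, integral_eq_inner, W.deriv_add, inner_add_left, h, map_add, star_add,
    dotProduct_add]
  ring

theorem form_smul_right (p : Lp ℝ ∞ unitMeasure) (q r : WNeg) (U : Matrix (Fin 2) (Fin 2) ℂ)
    (lam a : ℂ) (y z : W) :
    form p q r U lam y (a • z) = conj a * form p q r U lam y z := by
  have h : y.mulConj (a • z) = conj a • y.mulConj z := W.ext_val fun x hx => by
    rw [W.val_smul _ _ hx, W.val_mulConj _ _ hx, W.val_mulConj _ _ hx, W.val_smul _ _ hx,
      map_mul]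
    ring
  simp only [form, integral_eq_inner, W.deriv_smul, inner_smul_left, h, map_smul, star_smul,
    dotProduct_smul, smul_eq_mul, RCLike.star_def]
  ring

theorem norm_trace_apply_le (y : W) (i : Fin 2) : ‖trace y i‖ ≤ 3 * ‖y‖ := by
  fin_cases i
  · exact y.norm_val_le (by simp)
  · exact y.norm_val_le (by simp)

theorem form_bound (p : Lp ℝ ∞ unitMeasure) (q r : WNeg) (U : Matrix (Fin 2) (Fin 2) ℂ)
    (lam : ℂ) : ∃ C : ℝ, ∀ y z : W, ‖form p q r U lam y z‖ ≤ C * ‖y‖ * ‖z‖ := by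
  let v : Fin 2 → ℂ := fun i => boundaryMatrix U i i
  refine ⟨‖p‖ + ‖q - lam • r‖ * 9 + 9 * (‖v 0‖ + ‖v 1‖), fun y z => ?_⟩
  have h1 : ‖inner ℂ z.deriv (p • y.deriv : L2)‖ ≤ ‖p‖ * ‖y‖ * ‖z‖ := by
    refine (norm_inner_le_norm _ _).trans ?_
    have := Lp.norm_smul_le (r := 2) p y.deriv
    calc ‖z.deriv‖ * ‖(p • y.deriv : L2)‖ ≤ ‖z‖ * (‖p‖ * ‖y‖) :=
          mul_le_mul z.norm_deriv_le
            (this.trans (mul_le_mul_of_nonneg_left y.norm_deriv_le (norm_nonneg _)))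
            (norm_nonneg _) (norm_nonneg _)
      _ = _ := by ring
  have h2 : ‖(q - lam • r) (y.mulConj z)‖ ≤ ‖q - lam • r‖ * 9 * ‖y‖ * ‖z‖ := by
    refine (ContinuousLinearMap.le_opNorm _ _).trans ?_
    calc _ ≤ ‖q - lam • r‖ * (9 * ‖y‖ * ‖z‖) :=
          mul_le_mul_of_nonneg_left (y.norm_mulConj_le z) (norm_nonneg _)
      _ = _ := by ring
  have h3 : ∀ i, ‖v i * trace y i * conj (trace z i)‖ ≤ 9 * ‖v i‖ * ‖y‖ * ‖z‖ := fun i => by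
    rw [norm_mul, norm_mul, RCLike.norm_conj]
    calc _ ≤ ‖v i‖ * (3 * ‖y‖) * (3 * ‖z‖) := by
          gcongr
          · exact norm_trace_apply_le y i
          · exact norm_trace_apply_le z i
      _ = _ := by ring
  have h4 : (boundaryMatrix U).mulVec (trace y) ⬝ᵥ star (trace z) =
      v 0 * trace y 0 * conj (trace z 0) + v 1 * trace y 1 * conj (trace z 1) := by
    simp [boundaryMatrix, Matrix.mulVec_diagonal, dotProduct, Fin.sum_univ_two, v]
  rw [form, integral_eq_inner, h4]
  refine (norm_add₃_le).trans ?_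
  have h5 := norm_add_le (v 0 * trace y 0 * conj (trace z 0)) (v 1 * trace y 1 * conj (trace z 1))
  have h6 := h3 0
  have h7 := h3 1
  linarith

/-- The form as a bounded sesquilinear form on `ℌ_U`, antilinear argument first. -/
def boundedForm (p : Lp ℝ ∞ unitMeasure) (q r : WNeg) (U : Matrix (Fin 2) (Fin 2) ℂ)
    (lam : ℂ) : HU U →L⋆[ℂ] HU U →L[ℂ] ℂ :=
  LinearMap.mkContinuous₂
    (LinearMap.mk₂'ₛₗ (starRingEnd ℂ) (RingHom.id ℂ)
      (fun z y : HU U => form p q r U lam (y : W) (z : W))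
      (fun z₁ z₂ y => form_add_right p q r U lam y z₁ z₂)
      (fun a z y => form_smul_right p q r U lam a y z)
      (fun z y₁ y₂ => form_add_left p q r U lam y₁ y₂ z)
      (fun a z y => form_smul_left p q r U lam a y z))
    (form_bound p q r U lam).choose
    (fun z y => by
      have := (form_bound p q r U lam).choose_spec (y : W) (z : W)
      rw [mul_right_comm] at this
      exact this)

/-- The linear operator pencil `T : ℌ_U → ℌ'_U`, determined by
`⟨I⁺ T(λ) y, z⟩ = ∫ p y' z̄' dx + ∫ (q - λ r) y z̄ dx + ⟨V y^∧, z^∧⟩`. -/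
def pencil (p : Lp ℝ ∞ unitMeasure) (q r : WNeg) (U : Matrix (Fin 2) (Fin 2) ℂ)
    (lam : ℂ) : HU U →L[ℂ] HNeg U :=
  (Iplus U).symm.toContinuousLinearEquiv.toContinuousLinearMap ∘L
    ContinuousLinearMap.adjoint
      (InnerProductSpace.continuousLinearMapOfBilin (boundedForm p q r U lam))

/-- The operator `I⁺ T(λ)` on `ℌ_U`. -/
def plusPencil (p : Lp ℝ ∞ unitMeasure) (q r : WNeg) (U : Matrix (Fin 2) (Fin 2) ℂ)
    (lam : ℂ) : HU U →L[ℂ] HU U :=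
  (Iplus U).toContinuousLinearEquiv.toContinuousLinearMap ∘L pencil p q r U lam

/-- The identity that determines the pencil (Mathlib's inner product is antilinear in its first
argument). -/
theorem inner_plusPencil (p : Lp ℝ ∞ unitMeasure) (q r : WNeg) (U : Matrix (Fin 2) (Fin 2) ℂ)
    (lam : ℂ) (y z : HU U) :
    inner ℂ z (plusPencil p q r U lam y) = form p q r U lam (y : W) (z : W) := by
  have h : plusPencil p q r U lam y = ContinuousLinearMap.adjoint
      (InnerProductSpace.continuousLinearMapOfBilin (boundedForm p q r U lam)) y :=
    (Iplus U).apply_symm_apply _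
  rw [h, ContinuousLinearMap.adjoint_inner_right,
    InnerProductSpace.continuousLinearMapOfBilin_apply]
  rfl

/-- The index of inertia of a quadratic form `m` on a Hilbert space: the supremum of the dimensions
of the subspaces on which `m[y] ≤ -c ‖y‖²` for some `c > 0`. -/
def formIndex {E : Type*} [NormedAddCommGroup E] [InnerProductSpace ℂ E] (m : E → ℝ) : ℕ∞ :=
  ⨆ (M : Submodule ℂ E) (_ : ∃ c : ℝ, 0 < c ∧ ∀ y ∈ M, m y ≤ -c * ‖y‖ ^ 2),
    Cardinal.toENat (Module.rank ℂ M)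

/-- The index of inertia of a Hermitian operator `A`, i.e. of the form `⟨A y, y⟩`. -/
def operatorIndex {E : Type*} [NormedAddCommGroup E] [InnerProductSpace ℂ E] (A : E →L[ℂ] E) :
    ℕ∞ :=
  formIndex A.reApplyInnerSelf

end SturmLiouville

end

/-! The index is bounded from both sides by means of the quasi-derivative `u = p y' + a y`. By Riesz
representation the real functional `q - λ r` acts as `f ↦ ∫ (a f' + b f)` with real `a, b ∈ L₂`, so
the form has the density `p y' z̄' + a (y z̄)' + b y z̄`. An element of its kernel satisfies `u' = a
y' + b y`, together with natural boundary conditions wherever `U_kk ≠ 1` (`exists_isSolution`). This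
is a first-order system for `(y, u)` with integrable coefficients, so zero Cauchy data force `y =
0`. Hence an eigenfunction vanishes on no interval, and `u ≠ 0` at its zeros.

Lower bound (`card_zeros_le_operatorIndex`). For interior zeros `c₁ < ... < cₙ`, cut `y` off to zero
on the right of each `cᵢ`. The cut-off functions stay in `ℌ_U`, and the form of any two of them
equals the form of `y` with one of them, which is zero: they span an isotropic subspace. A
combination of them that lies in the kernel of `I⁺T(λ)` is a solution vanishing on `[cₙ, 1]`, so it
is zero, and comparing it on the two sides of each `cᵢ` makes all coefficients zero. An isotropic
space on which the operator `A` is injective is tilted by `x ↦ x - e A x` into a uniformly negative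
space of the same dimension (`card_le_operatorIndex`).

Upper bound (`operatorIndex_le_encard_zeros`). If `z ∈ ℌ_U` vanishes at the zeros of `y`, Picone's
identity says that the density of `z` exceeds the derivative of `(u / y) |z|²` by `p |z' - (y' / y)
z|² ≥ 0`. Integrating between zeros and using the boundary conditions makes the form nonnegative at
`z` (`form_nonneg`), while vanishing at `n` interior zeros imposes `n` linear conditions. Two points
need care. The eigenfunction is complex, but `u ȳ` is real, so `y' / y` is real. And `y'` is only in
`L₂`, so the continuity of `(u / y) |z|²` at a zero rests on `|y|` growing at least linearly there
(`exists_linear_le`) while `|z|²` is `o(|x - x₀|)`.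

Everything takes place in `ℕ∞`, so the zero set need not be known to be finite in advance. -/

noncomputable section

namespace SturmLiouville

/-! ### Bounds for the index of inertia of an abstract form. -/

section Index

variable {E : Type*} [NormedAddCommGroup E] [InnerProductSpace ℂ E]

/-- An isotropic subspace on which a symmetric operator is injective bounds the index of inertia
from below. -/
theorem card_le_operatorIndex {ι : Type*} [Fintype ι] (A : E →L[ℂ] E)
    (hA : ∀ x y, inner ℂ (A x) y = inner ℂ x (A y)) (v : ι → E)
    (hv : ∀ i j, inner ℂ (v i) (A (v j)) = 0)
    (hinj : ∀ a : ι → ℂ, A (∑ i, a i • v i) = 0 → a = 0) :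
    (Fintype.card ι : ℕ∞) ≤ operatorIndex A := by
  classical
  let L : (ι → ℂ) →ₗ[ℂ] E := Fintype.linearCombination ℂ v
  have hL : ∀ a, L a = ∑ i, a i • v i := fun a => Fintype.linearCombination_apply ℂ v a
  have hiso : ∀ a, inner ℂ (L a) (A (L a)) = 0 := fun a => by
    rw [hL, map_sum, sum_inner]
    refine Finset.sum_eq_zero fun i _ => ?_
    rw [inner_sum]
    refine Finset.sum_eq_zero fun j _ => ?_
    rw [map_smul, inner_smul_left, inner_smul_right, hv]
    ring
  -- Injectivity on a finite-dimensional space is quantitative; this makes the final negative bound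
  -- uniform.
  obtain ⟨K, hK, hK'⟩ := (A.toLinearMap ∘ₗ L).exists_antilipschitzWith
    (LinearMap.ker_eq_bot'.2 fun a ha => hinj a (by rw [← hL]; exact ha))
  have hbound : ∀ a, ‖a‖ ≤ K * ‖A (L a)‖ := fun a => by
    simpa using hK'.le_mul_norm (f := A.toLinearMap ∘ₗ L) (by simp) a
  -- For isotropic `x`, the form at `x - e A x` is `-2e ‖A x‖² + e² ⟨A² x, A x⟩`. With `e ‖A‖ ≤ 1`
  -- the second term costs at most `e ‖A x‖²`, which leaves `-e ‖A x‖²`.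
  set e : ℝ := 1 / (1 + ‖A‖) with he
  have he0 : 0 < e := by positivity
  have heA : e * ‖A‖ ≤ 1 := by
    rw [he, div_mul_eq_mul_div, one_mul, div_le_one (by positivity)]
    linarith [norm_nonneg A]
  let N : (ι → ℂ) →ₗ[ℂ] E := L - (e : ℂ) • (A.toLinearMap ∘ₗ L)
  have hN : ∀ a, N a = L a - (e : ℂ) • A (L a) := fun a => rfl
  have hform : ∀ a, A.reApplyInnerSelf (N a) ≤ -e * ‖A (L a)‖ ^ 2 := fun a => by
    have h1 : inner ℂ (A (N a)) (N a) = - (2 * e : ℂ) * inner ℂ (A (L a)) (A (L a)) +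
        (e : ℂ) ^ 2 * inner ℂ (A (A (L a))) (A (L a)) := by
      rw [hN, map_sub, map_smul, inner_sub_left, inner_sub_right, inner_sub_right,
        inner_smul_left, inner_smul_right, inner_smul_right, inner_smul_left, hA (L a) (L a),
        hiso, hA (A (L a)) (L a), Complex.conj_ofReal]
      ring
    have h2 : (inner ℂ (A (A (L a))) (A (L a)) : ℂ).re ≤ ‖A‖ * ‖A (L a)‖ ^ 2 := by
      refine (Complex.re_le_norm _).trans ((norm_inner_le_norm _ _).trans ?_)
      have := A.le_opNorm (A (L a))
      nlinarith [norm_nonneg (A (L a))]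
    rw [ContinuousLinearMap.reApplyInnerSelf_apply, h1, inner_self_eq_norm_sq_to_K]
    have h3 : RCLike.re (-(2 * e : ℂ) * ((‖A (L a)‖ : ℝ) : ℂ) ^ 2 +
        (e : ℂ) ^ 2 * inner ℂ (A (A (L a))) (A (L a))) =
        -(2 * e) * ‖A (L a)‖ ^ 2 + e ^ 2 * (inner ℂ (A (A (L a))) (A (L a)) : ℂ).re := by
      have h4 : -(2 * e : ℂ) * ((‖A (L a)‖ : ℝ) : ℂ) ^ 2 =
        ((-(2 * e) * ‖A (L a)‖ ^ 2 : ℝ) : ℂ) := by push_cast; ring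
      have h5 : (e : ℂ) ^ 2 = ((e ^ 2 : ℝ) : ℂ) := by push_cast; ring
      rw [h4, h5]
      simp only [RCLike.re_to_complex, Complex.add_re, Complex.ofReal_re, Complex.re_ofReal_mul]
    refine h3.trans_le ?_
    have h6 : e ^ 2 * (inner ℂ (A (A (L a))) (A (L a)) : ℂ).re ≤
        e ^ 2 * (‖A‖ * ‖A (L a)‖ ^ 2) := by gcongr
    have h7 : e ^ 2 * (‖A‖ * ‖A (L a)‖ ^ 2) ≤ e * ‖A (L a)‖ ^ 2 := by
      calc _ = (e * ‖A (L a)‖ ^ 2) * (e * ‖A‖) := by ring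
        _ ≤ (e * ‖A (L a)‖ ^ 2) * 1 := by gcongr
        _ = _ := by ring
    linarith
  have hNinj : Function.Injective N := by
    refine (injective_iff_map_eq_zero N).2 fun a ha => ?_
    have h1 := hform a
    rw [ha, ContinuousLinearMap.reApplyInnerSelf_apply, map_zero, inner_zero_left, map_zero] at h1
    have h2 : ‖A (L a)‖ ^ 2 ≤ 0 := by
      by_contra h
      push Not at h
      nlinarith
    have h3 : A (L a) = 0 := by
      rw [← norm_eq_zero]
      nlinarith [norm_nonneg (A (L a))]
    exact hinj a (by rw [← hL]; exact h3)
  set N' := LinearMap.toContinuousLinearMap N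
  -- Turns the bound in `‖A (L a)‖` into one in `‖N a‖`; the summand `1` only keeps the constant
  -- positive.
  have hD : ∀ a, ‖N a‖ ≤ (‖N'‖ * K + 1) * ‖A (L a)‖ := fun a => by
    have h1 : ‖N a‖ ≤ ‖N'‖ * ‖a‖ := N'.le_opNorm a
    have h2 := mul_le_mul_of_nonneg_left (hbound a) (norm_nonneg N')
    linarith [norm_nonneg (A (L a))]
  have hDpos : 0 < ‖N'‖ * K + 1 := by positivity
  have hrank : Cardinal.toENat (Module.rank ℂ (LinearMap.range N)) = (Fintype.card ι : ℕ∞) := by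
    have h1 := congrArg Cardinal.toENat (LinearEquiv.ofInjective N hNinj).lift_rank_eq
    rw [rank_fun'] at h1
    simpa using h1.symm
  rw [← hrank]
  unfold operatorIndex formIndex
  refine le_iSup₂_of_le (LinearMap.range N) ⟨e / (‖N'‖ * K + 1) ^ 2, by positivity, ?_⟩ le_rfl
  rintro _ ⟨a, rfl⟩
  refine (hform a).trans ?_
  have h1 : ‖N a‖ ^ 2 ≤ (‖N'‖ * K + 1) ^ 2 * ‖A (L a)‖ ^ 2 := by
    rw [← mul_pow]
    exact pow_le_pow_left₀ (norm_nonneg _) (hD a) 2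
  have h2 : e / (‖N'‖ * K + 1) ^ 2 * ‖N a‖ ^ 2 ≤ e * ‖A (L a)‖ ^ 2 := by
    rw [div_mul_eq_mul_div, div_le_iff₀ (by positivity)]
    nlinarith
  linarith

/-- If the form `m` is nonnegative on the common kernel of `n` linear functionals, then its index
of inertia is at most `n`. -/
theorem formIndex_le_card {ι : Type*} [Fintype ι] (m : E → ℝ) (l : E →ₗ[ℂ] (ι → ℂ))
    (h : ∀ z, l z = 0 → 0 ≤ m z) : formIndex m ≤ (Fintype.card ι : ℕ∞) := by
  refine iSup₂_le fun M hM => ?_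
  obtain ⟨c, hc, hM⟩ := hM
  -- A negative subspace meets the kernel of `l` only in zero, so `l` embeds it into `ι → ℂ`.
  have hinj : Function.Injective (l ∘ₗ M.subtype) := by
    refine (injective_iff_map_eq_zero _).2 fun z hz => ?_
    have h1 := (h _ hz).trans (hM _ z.2)
    have h2 : ‖M.subtype z‖ ^ 2 ≤ 0 := by
      by_contra h
      push Not at h
      have : 0 < c * ‖(z : E)‖ ^ 2 := mul_pos hc h
      simp only [Submodule.subtype_apply] at h1
      linarith
    have h3 : ‖(z : E)‖ = 0 := by
      have : ‖(z : E)‖ ^ 2 ≤ 0 := h2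
      nlinarith [norm_nonneg (z : E)]
    exact Subtype.ext (norm_eq_zero.1 h3)
  have h4 := LinearMap.lift_rank_le_of_injective _ hinj
  rw [rank_fun'] at h4
  have h5 := Cardinal.toENat.monotone' h4
  simpa using h5

end Index

/-! Elements of `W₂¹[0,1]` given by the initial value and the derivative. -/

theorem L2.memLp_const_add_primitive (c : ℂ) (g : L2) :
    MemLp (fun x : ℝ => c + ∫ t in (0 : ℝ)..x, g t) 2 unitMeasure :=
  (memLp_const c).add g.memLp_primitive

/-- The function `c + ∫₀ˣ g` as an element of `W₂¹[0,1]`. -/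
def W.ofDeriv (c : ℂ) (g : L2) : W :=
  ⟨WithLp.toLp 2 ((L2.memLp_const_add_primitive c g).toLp _, g), c,
    (L2.memLp_const_add_primitive c g).coeFn_toLp⟩

theorem W.deriv_ofDeriv (c : ℂ) (g : L2) : (W.ofDeriv c g).deriv = g := rfl

theorem W.initial_ofDeriv (c : ℂ) (g : L2) : (W.ofDeriv c g).initial = c :=
  W.initial_eq _ (L2.memLp_const_add_primitive c g).coeFn_toLp

theorem W.val_ofDeriv (c : ℂ) (g : L2) (x : ℝ) :
    (W.ofDeriv c g).val x = c + ∫ t in (0 : ℝ)..x, g t := by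
  rw [W.val, W.initial_ofDeriv, W.deriv_ofDeriv]

theorem W.val_zero_eq (w : W) : w.val 0 = w.initial := by
  simp [W.val]

/-- The complex conjugate of an element of `W₂¹[0,1]`. -/
def W.conj (w : W) : W := W.ofDeriv (starRingEnd ℂ w.initial) w.deriv.conj

theorem W.val_conj (w : W) {x : ℝ} (hx : x ∈ Icc (0 : ℝ) 1) :
    w.conj.val x = starRingEnd ℂ (w.val x) := by
  rw [W.conj, W.val_ofDeriv, L2.primitive_conj _ hx, W.val, map_add]

theorem W.deriv_conj_ae (w : W) :
    ∀ᵐ x ∂unitMeasure, w.conj.deriv x = starRingEnd ℂ (w.deriv x) := w.deriv.conj_ae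

/-! ### Real functionals as integrals. -/

theorem W.inner_eq (w f : W) :
    inner ℂ w f = ∫ x, (starRingEnd ℂ (w.deriv x) * f.deriv x +
      starRingEnd ℂ (w.val x) * f.val x) ∂unitMeasure := by
  have h : inner ℂ w f = inner ℂ w.1.fst f.1.fst + inner ℂ w.deriv f.deriv :=
    WithLp.prod_inner_apply w.1 f.1
  rw [h, L2.inner_def, L2.inner_def,
    ← integral_add (L2.integrable_inner _ _) (L2.integrable_inner _ _)]
  refine integral_congr_ae ?_
  filter_upwards [w.val_ae, f.val_ae] with x h1 h2
  rw [h1, h2, RCLike.inner_apply, RCLike.inner_apply]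
  ring

/-- Both `f + f̄` and `i (f - f̄)` are real functions; the reality of `Q` on them gives the
imaginary and the real part of the identity. -/
theorem WNeg.IsReal.apply_conj {Q : WNeg} (hQ : Q.IsReal) (f : W) :
    Q f.conj = starRingEnd ℂ (Q f) := by
  have h1 := hQ (f + f.conj) fun x hx => by
    rw [W.val_add _ _ hx, W.val_conj _ hx]; simp
  have h2 := hQ (Complex.I • (f + (-1 : ℂ) • f.conj)) fun x hx => by
    rw [W.val_smul _ _ hx, W.val_add _ _ hx, W.val_smul _ _ hx, W.val_conj _ hx]; simp
  simp only [map_add, map_smul, Complex.add_im, smul_eq_mul, Complex.I_mul_im, Complex.add_re,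
    neg_mul, one_mul, Complex.neg_re] at h1 h2
  refine Complex.ext ?_ ?_
  · rw [Complex.conj_re]; linarith
  · rw [Complex.conj_im]; linarith

theorem WNeg.IsReal.sub_ofReal_smul {q r : WNeg} (hq : q.IsReal) (hr : r.IsReal) (lam : ℝ) :
    WNeg.IsReal (q - (lam : ℂ) • r) := fun y hy => by
  simp [hq y hy, hr y hy]

/-- A real element of `W₂⁻¹[0,1]` is `f ↦ ∫ (a f' + b f)` with real `a, b ∈ L₂[0,1]`. -/
theorem WNeg.IsReal.exists_integral {Q : WNeg} (hQ : Q.IsReal) :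
    ∃ a b : ℝ → ℝ, MemLp a 2 unitMeasure ∧ MemLp b 2 unitMeasure ∧
      ∀ f : W, Q f = ∫ x, ((a x : ℂ) * f.deriv x + (b x : ℂ) * f.val x) ∂unitMeasure := by
  set w : W := (InnerProductSpace.toDual ℂ W).symm Q with hw
  have hQw : ∀ f, Q f = inner ℂ w f := fun f =>
    (InnerProductSpace.toDual_symm_apply (x := f) (y := Q)).symm
  have hi : ∀ f : W, Integrable (fun x => starRingEnd ℂ (w.deriv x) * f.deriv x +
      starRingEnd ℂ (w.val x) * f.val x) unitMeasure := fun f =>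
    ((Lp.memLp w.deriv).star.integrable_mul (Lp.memLp f.deriv)).add
      (w.memLp_val.star.integrable_mul f.memLp_val)
  refine ⟨fun x => (w.deriv x).re, fun x => (w.val x).re, (Lp.memLp w.deriv).re, w.memLp_val.re,
    fun f => ?_⟩
  -- Averaging the Riesz formula with its conjugate replaces the representative `w` by its real
  -- part.
  have h1 : Q f = (1 / 2 : ℂ) * (inner ℂ w f + starRingEnd ℂ (inner ℂ w f.conj)) := by
    rw [← hQw, ← hQw, hQ.apply_conj, Complex.conj_conj]
    ring
  have h3 : Integrable (fun x => starRingEnd ℂ (starRingEnd ℂ (w.deriv x) * f.conj.deriv x +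
      starRingEnd ℂ (w.val x) * f.conj.val x)) unitMeasure :=
    Complex.conjCLE.toContinuousLinearMap.integrable_comp (hi f.conj)
  rw [h1, W.inner_eq, W.inner_eq, ← integral_conj,
    ← integral_add (hi f) h3, ← integral_const_mul]
  refine integral_congr_ae ?_
  filter_upwards [ae_mem, f.deriv_conj_ae] with x hx h2
  rw [h2, f.val_conj hx, Complex.re_eq_add_conj, Complex.re_eq_add_conj]
  simp only [map_add, map_mul, Complex.conj_conj]
  ring

/-! ### Reduction to a form with real coefficients. -/

/-- Coefficients of the form
`∫ (p y' z̄' + a (y z̄)' + b y z̄) dx + v₀ y(0) z̄(0) + v₁ y(1) z̄(1)`. -/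
structure SturmData where
  p : ℝ → ℝ
  a : ℝ → ℝ
  b : ℝ → ℝ
  v₀ : ℝ
  v₁ : ℝ
  lower : ℝ
  upper : ℝ
  lower_pos : 0 < lower
  aestronglyMeasurable_p : AEStronglyMeasurable p unitMeasure
  lower_le : ∀ᵐ x ∂unitMeasure, lower ≤ p x
  le_upper : ∀ᵐ x ∂unitMeasure, p x ≤ upper
  memLp_a : MemLp a 2 unitMeasure
  memLp_b : MemLp b 2 unitMeasure

namespace SturmData

variable (d : SturmData)

/-- The integrand of the form. -/
def density (y z : W) (x : ℝ) : ℂ :=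
  (d.p x : ℂ) * y.deriv x * conj (z.deriv x) +
    (d.a x : ℂ) * (y.deriv x * conj (z.val x) + y.val x * conj (z.deriv x)) +
    (d.b x : ℂ) * (y.val x * conj (z.val x))

/-- The sesquilinear form of the coefficients `d`. -/
def form (y z : W) : ℂ :=
  (∫ x, d.density y z x ∂unitMeasure) + d.v₀ * (y.val 0 * conj (z.val 0)) +
    d.v₁ * (y.val 1 * conj (z.val 1))

theorem norm_p_le : ∀ᵐ x ∂unitMeasure, ‖d.p x‖ ≤ d.upper := by
  filter_upwards [d.lower_le, d.le_upper] with x h1 h2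
  rw [Real.norm_eq_abs, abs_of_nonneg (d.lower_pos.le.trans h1)]
  exact h2

theorem lower_le_upper : d.lower ≤ d.upper := by
  obtain ⟨x, h1, h2⟩ := (d.lower_le.and d.le_upper).exists
  exact h1.trans h2

theorem upper_pos : 0 < d.upper := d.lower_pos.trans_le d.lower_le_upper

theorem memLp_p_mul {f : ℝ → ℂ} (hf : MemLp f 2 unitMeasure) :
    MemLp (fun x => (d.p x : ℂ) * f x) 2 unitMeasure := by
  refine hf.of_le_mul (c := d.upper)
    ((Complex.continuous_ofReal.comp_aestronglyMeasurable d.aestronglyMeasurable_p).mul hf.1) ?_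
  filter_upwards [d.norm_p_le] with x hx
  rw [norm_mul, Complex.norm_real]
  exact mul_le_mul_of_nonneg_right hx (norm_nonneg _)

end SturmData

theorem memLp_mul_continuousOn {f u : ℝ → ℂ} (hf : MemLp f 2 unitMeasure)
    (hu : ContinuousOn u (Icc 0 1)) : MemLp (fun x => f x * u x) 2 unitMeasure := by
  obtain ⟨C, hC⟩ := isCompact_Icc.exists_bound_of_continuousOn hu
  refine hf.of_le_mul (c := C) (hf.1.mul (hu.aestronglyMeasurable measurableSet_Icc)) ?_
  filter_upwards [ae_mem] with x hx
  rw [norm_mul, mul_comm]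
  exact mul_le_mul_of_nonneg_right (hC x hx) (norm_nonneg _)

namespace SturmData

variable (d : SturmData)

theorem integrable_first (y z : W) :
    Integrable (fun x => (d.p x : ℂ) * y.deriv x * conj (z.deriv x)) unitMeasure :=
  (d.memLp_p_mul (Lp.memLp y.deriv)).integrable_mul (Lp.memLp z.deriv).star

theorem integrable_second (y z : W) :
    Integrable (fun x => (d.a x : ℂ) * (y.deriv x * conj (z.val x) + y.val x * conj (z.deriv x)) +
      (d.b x : ℂ) * (y.val x * conj (z.val x))) unitMeasure := by
  have h1 := (memLp_mul_continuousOn (Lp.memLp y.deriv) z.continuousOn_conj_val).add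
    ((memLp_mul_continuousOn z.deriv.memLp_conj y.continuousOn_val).ae_eq
      (Filter.Eventually.of_forall fun x => mul_comm _ _))
  exact (d.memLp_a.ofReal.integrable_mul h1).add (d.memLp_b.ofReal.integrable_mul
    (memLp_mul_continuousOn y.memLp_val z.continuousOn_conj_val))

theorem integrable_density (y z : W) : Integrable (d.density y z) unitMeasure := by
  refine ((d.integrable_first y z).add (d.integrable_second y z)).congr
    (Filter.Eventually.of_forall fun x => ?_)
  simp only [density, Pi.add_apply]
  ring

theorem form_conj (y z : W) : d.form z y = conj (d.form y z) := by
  have h : ∀ x, d.density z y x = conj (d.density y z x) := fun x => by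
    simp only [density, map_add, map_mul, Complex.conj_ofReal, Complex.conj_conj]
    ring
  simp only [form, h, integral_conj, map_add, map_mul, Complex.conj_ofReal, Complex.conj_conj]
  ring

end SturmData

/-- The form of the pencil in terms of real coefficients. -/
theorem exists_sturmData (p : Lp ℝ ∞ unitMeasure)
    (hp : ∃ c : ℝ, 0 < c ∧ ∀ᵐ x ∂unitMeasure, c ≤ p x) (q r : WNeg) (hq : q.IsReal)
    (hr : r.IsReal) (U : Matrix (Fin 2) (Fin 2) ℂ) (lam : ℝ) :
    ∃ d : SturmData, ∀ y z : W, form p q r U (lam : ℂ) y z = d.form y z := by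
  obtain ⟨c, hc, hpc⟩ := hp
  obtain ⟨a, b, ha, hb, hQ⟩ := (hq.sub_ofReal_smul hr lam).exists_integral
  let v : Fin 2 → ℝ := fun k =>
    open scoped Classical in if U k k = 1 then 0 else -Real.cot (Complex.arg (U k k) / 2)
  have hv : boundaryMatrix U = Matrix.diagonal fun k => (v k : ℂ) := by
    unfold boundaryMatrix
    congr 1
    funext k
    simp only [v]
    split_ifs <;> simp
  have hup : ∀ᵐ x ∂unitMeasure, p x ≤ ‖p‖ := by
    filter_upwards [ae_le_eLpNormEssSup (f := p) (μ := unitMeasure)] with x hx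
    refine (le_abs_self _).trans ?_
    rw [Lp.norm_def, eLpNorm_exponent_top, ← Real.norm_eq_abs, ← toReal_enorm]
    refine ENNReal.toReal_mono ?_ hx
    have := Lp.eLpNorm_ne_top p
    rwa [eLpNorm_exponent_top] at this
  let d : SturmData := ⟨p, a, b, v 0, v 1, c, ‖p‖, hc, Lp.aestronglyMeasurable p, hpc, hup, ha, hb⟩
  refine ⟨d, fun y z => ?_⟩
  have h1 : (∫ x, (p x : ℂ) * y.deriv x * conj (z.deriv x) ∂unitMeasure) +
      (q - (lam : ℂ) • r) (y.mulConj z) = ∫ x, d.density y z x ∂unitMeasure := by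
    have h2 : (q - (lam : ℂ) • r) (y.mulConj z) = ∫ x, ((d.a x : ℂ) *
        (y.deriv x * conj (z.val x) + y.val x * conj (z.deriv x)) +
        (d.b x : ℂ) * (y.val x * conj (z.val x))) ∂unitMeasure := by
      rw [hQ]
      refine integral_congr_ae ?_
      filter_upwards [ae_mem, Lp.coeFn_add (L2.cmul _ z.continuousOn_conj_val y.deriv)
        (L2.cmul _ y.continuousOn_val z.deriv.conj), L2.cmul_ae _ z.continuousOn_conj_val y.deriv,
        L2.cmul_ae _ y.continuousOn_val z.deriv.conj, z.deriv.conj_ae] with x hx h3 h4 h5 h6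
      rw [W.val_mulConj _ _ hx]
      have h7 : (y.mulConj z).deriv x =
        y.deriv x * conj (z.val x) + y.val x * conj (z.deriv x) := by
        change y.derivMulConj z x = _
        rw [W.derivMulConj, h3, Pi.add_apply, h4, h5, h6]
        ring
      rw [h7]
    rw [h2]
    refine (integral_add (d.integrable_first y z) (d.integrable_second y z)).symm.trans ?_
    refine integral_congr_ae (Filter.Eventually.of_forall fun x => ?_)
    simp only [SturmData.density]
    ring
  have h4 : (boundaryMatrix U).mulVec (trace y) ⬝ᵥ star (trace z) =
      d.v₀ * (y.val 0 * conj (z.val 0)) + d.v₁ * (y.val 1 * conj (z.val 1)) := by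
    rw [hv]
    simp [Matrix.mulVec_diagonal, dotProduct, Fin.sum_univ_two, trace, d]
    ring
  rw [SturmLiouville.form, h1, h4, SturmData.form]
  ring

/-! ### Boundary conditions for diagonal `U`. -/

theorem isDiag_eq_diagonal {U : Matrix (Fin 2) (Fin 2) ℂ} (hU : U.IsDiag) :
    U = Matrix.diagonal fun k => U k k := by
  ext i j
  by_cases h : i = j
  · simp [h]
  · simp [h, hU h]

theorem mem_HU_iff {U : Matrix (Fin 2) (Fin 2) ℂ} (hU : U.IsDiag) {y : W} :
    y ∈ HU U ↔ (U 0 0 = 1 → y.val 0 = 0) ∧ (U 1 1 = 1 → y.val 1 = 0) := by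
  have h : y ∈ HU U ↔ ∃ c : Fin 2 → ℂ, (U - 1).mulVec c = trace y := Iff.rfl
  have hsub : U - 1 = Matrix.diagonal fun k => U k k - 1 := by
    conv_lhs => rw [isDiag_eq_diagonal hU, ← Matrix.diagonal_one, Matrix.diagonal_sub]
  have h0 : trace y 0 = y.val 0 := rfl
  have h1 : trace y 1 = y.val 1 := rfl
  rw [h, hsub]
  constructor
  · rintro ⟨c, hc⟩
    rw [← h0, ← h1, ← hc]
    simp +contextual [Matrix.mulVec_diagonal]
  · rintro ⟨h2, h3⟩
    -- Where `U k k = 1` the division gives `0`; there the trace component is `0` as well.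
    refine ⟨fun k => trace y k / (U k k - 1), ?_⟩
    have key : ∀ u t : ℂ, (u = 1 → t = 0) → (u - 1) * (t / (u - 1)) = t := fun u t hut => by
      by_cases hu : u = 1
      · simp [hut hu]
      · exact mul_div_cancel₀ _ (sub_ne_zero.2 hu)
    funext k
    rw [Matrix.mulVec_diagonal]
    fin_cases k
    · exact key _ _ h2
    · exact key _ _ h3

/-! The quasi-derivative of an element of the kernel. -/

theorem intervalIntegrable_of_integrable {F : Type*} [NormedAddCommGroup F] {f : ℝ → F}
    (hf : Integrable f unitMeasure) {x y : ℝ} (hx : x ∈ Icc (0 : ℝ) 1) (hy : y ∈ Icc (0 : ℝ) 1) :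
    IntervalIntegrable f volume x y := by
  have h : IntegrableOn f (Icc (0 : ℝ) 1) volume := hf
  exact (h.mono_set (uIcc_subset_Icc hx hy)).intervalIntegrable

theorem integral_unitMeasure {F : Type*} [NormedAddCommGroup F] [NormedSpace ℝ F] (f : ℝ → F) :
    ∫ x, f x ∂unitMeasure = ∫ x in (0 : ℝ)..1, f x := by
  rw [intervalIntegral.integral_of_le zero_le_one, ← integral_Icc_eq_integral_Ioc]

theorem ae_uIoc {P : ℝ → Prop} (h : ∀ᵐ x ∂unitMeasure, P x) {x y : ℝ}
    (hx : x ∈ Icc (0 : ℝ) 1) (hy : y ∈ Icc (0 : ℝ) 1) :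
    ∀ᵐ t ∂volume, t ∈ uIoc x y → P t := by
  filter_upwards [(ae_restrict_iff' measurableSet_Icc).1 h] with t ht hxy
  exact ht (uIcc_subset_Icc hx hy (uIoc_subset_uIcc hxy))

theorem zero_mem_unit : (0 : ℝ) ∈ Icc (0 : ℝ) 1 := by simp

theorem one_mem_unit : (1 : ℝ) ∈ Icc (0 : ℝ) 1 := by simp

theorem W.val_sub_val (w : W) {x y : ℝ} (hx : x ∈ Icc (0 : ℝ) 1) (hy : y ∈ Icc (0 : ℝ) 1) :
    w.val y - w.val x = ∫ t in x..y, w.deriv t := by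
  rw [W.val, W.val, add_sub_add_left_eq_sub, intervalIntegral.integral_interval_sub_left
    (w.deriv.intervalIntegrable zero_mem_unit hy) (w.deriv.intervalIntegrable zero_mem_unit hx)]

theorem continuousOn_primitive_of_integrable {F : Type*} [NormedAddCommGroup F] [NormedSpace ℝ F]
    {f : ℝ → F} (hf : Integrable f unitMeasure) :
    ContinuousOn (fun x => ∫ t in (0 : ℝ)..x, f t) (Icc 0 1) := by
  have h : IntegrableOn f (uIcc (0 : ℝ) 1) volume := by rw [uIcc_of_le zero_le_one]; exact hf
  simpa only [uIcc_of_le (zero_le_one' ℝ)] using intervalIntegral.continuousOn_primitive_interval h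

theorem memLp_of_continuousOn {f : ℝ → ℂ} (hf : ContinuousOn f (Icc 0 1)) :
    MemLp f 2 unitMeasure := by
  obtain ⟨C, hC⟩ := isCompact_Icc.exists_bound_of_continuousOn hf
  refine MemLp.of_bound (hf.aestronglyMeasurable measurableSet_Icc) C ?_
  filter_upwards [ae_mem] with x hx using hC x hx

/-- Integration by parts for the product of a primitive and the conjugate of `z ∈ W₂¹[0,1]`. -/
theorem W.integral_primitive_mul_conj (z : W) {f : ℝ → ℂ} (hf : Integrable f unitMeasure) :
    ∫ x, ((∫ t in (0 : ℝ)..x, f t) * conj (z.deriv x) + f x * conj (z.val x)) ∂unitMeasure =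
      (∫ t in (0 : ℝ)..1, f t) * conj (z.val 1) := by
  have hF := continuousOn_primitive_of_integrable hf
  have hG := z.deriv.conj.continuousOn_primitive
  have i1 : IntervalIntegrable (fun x => (∫ t in (0 : ℝ)..x, f t) * z.deriv.conj x) volume 0 1 :=
    (z.deriv.conj.intervalIntegrable zero_mem_unit one_mem_unit).continuousOn_mul
      (by rwa [uIcc_of_le zero_le_one])
  have i2 : IntervalIntegrable (fun x => f x * ∫ t in (0 : ℝ)..x, z.deriv.conj t) volume 0 1 :=
    (intervalIntegrable_of_integrable hf zero_mem_unit one_mem_unit).mul_continuousOn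
      (by rwa [uIcc_of_le zero_le_one])
  have i3 : IntervalIntegrable (fun x => f x * conj z.initial) volume 0 1 :=
    (intervalIntegrable_of_integrable hf zero_mem_unit one_mem_unit).mul_const _
  have h1 : ∫ x, ((∫ t in (0 : ℝ)..x, f t) * conj (z.deriv x) + f x * conj (z.val x))
      ∂unitMeasure = ∫ x in (0 : ℝ)..1, (f x * conj z.initial +
        (f x * (∫ t in (0 : ℝ)..x, z.deriv.conj t) +
          (∫ t in (0 : ℝ)..x, f t) * z.deriv.conj x)) := by
    rw [← integral_unitMeasure]
    refine integral_congr_ae ?_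
    filter_upwards [ae_mem, z.deriv.conj_ae] with x hx h2
    rw [h2, L2.primitive_conj _ hx, W.val, map_add]
    ring
  rw [h1, intervalIntegral.integral_add i3 (i2.add i1), intervalIntegral.integral_add i2 i1,
    ← integral_mul_integral zero_le_one _ (z.deriv.conj.integrableOn one_mem_unit),
    intervalIntegral.integral_mul_const, L2.primitive_conj _ one_mem_unit, W.val, map_add]
  · ring
  · exact (intervalIntegrable_iff_integrableOn_Ioc_of_le zero_le_one).1
      (intervalIntegrable_of_integrable hf zero_mem_unit one_mem_unit)

namespace SturmData

variable (d : SturmData)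

/-- The derivative `a y' + b y` of the quasi-derivative. -/
def rate (y : W) (x : ℝ) : ℂ := (d.a x : ℂ) * y.deriv x + (d.b x : ℂ) * y.val x

theorem integrable_rate (y : W) : Integrable (d.rate y) unitMeasure :=
  (d.memLp_a.ofReal.integrable_mul (Lp.memLp y.deriv)).add
    (d.memLp_b.ofReal.integrable_mul y.memLp_val)

/-- `u = p y' + a y` is the quasi-derivative of the solution `y` of `-(p y' + a y)' + a y' + b y = 0`. -/
structure IsSolution (y : W) (u : ℝ → ℂ) : Prop where
  ae_eq : ∀ᵐ x ∂unitMeasure, u x = (d.p x : ℂ) * y.deriv x + (d.a x : ℂ) * y.val x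
  eq_add_integral : ∀ x ∈ Icc (0 : ℝ) 1, u x = u 0 + ∫ t in (0 : ℝ)..x, d.rate y t

/-- Du Bois-Reymond's argument: after integration by parts, `f = p y' + a y - ∫ (a y' + b y)` is
orthogonal to every `z'` with `z` vanishing at both ends, hence is a constant `u₀`. What remains of
the form are boundary terms, and each endpoint with `U_kk ≠ 1` allows a test function that is
nonzero there, which yields its natural condition. -/
theorem exists_isSolution {U : Matrix (Fin 2) (Fin 2) ℂ} (hU : U.IsDiag) {y : W}
    (hy : ∀ z ∈ HU U, d.form y z = 0) :
    ∃ u, d.IsSolution y u ∧ (U 0 0 = 1 ∨ u 0 = d.v₀ * y.val 0) ∧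
      (U 1 1 = 1 ∨ u 1 = -(d.v₁ * y.val 1)) := by
  set B : ℝ → ℂ := fun x => ∫ t in (0 : ℝ)..x, d.rate y t with hB
  have hBc : ContinuousOn B (Icc 0 1) := continuousOn_primitive_of_integrable (d.integrable_rate y)
  set f : ℝ → ℂ := fun x => (d.p x : ℂ) * y.deriv x + (d.a x : ℂ) * y.val x - B x with hf
  have hfm : MemLp f 2 unitMeasure :=
    ((d.memLp_p_mul (Lp.memLp y.deriv)).add
      (memLp_mul_continuousOn d.memLp_a.ofReal y.continuousOn_val)).sub (memLp_of_continuousOn hBc)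
  have hform : ∀ z : W, d.form y z = (∫ x, f x * conj (z.deriv x) ∂unitMeasure) +
      B 1 * conj (z.val 1) + d.v₀ * (y.val 0 * conj (z.val 0)) +
        d.v₁ * (y.val 1 * conj (z.val 1)) := fun z => by
    have i1 : Integrable (fun x => f x * conj (z.deriv x)) unitMeasure :=
      hfm.integrable_mul z.deriv.memLp_conj
    have i2 : Integrable (fun x => B x * conj (z.deriv x) + d.rate y x * conj (z.val x))
        unitMeasure := by
      have : Integrable (fun x => d.density y z x - f x * conj (z.deriv x)) unitMeasure :=
        (d.integrable_density y z).sub i1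
      refine this.congr (Filter.Eventually.of_forall fun x => ?_)
      simp only [density, rate, hf]
      ring
    rw [SturmData.form, ← z.integral_primitive_mul_conj (d.integrable_rate y), ← integral_add i1 i2]
    congr 3
    funext x
    simp only [density, rate, hf]
    ring
  set u₀ : ℂ := ∫ x, f x ∂unitMeasure with hu₀
  have hgm : MemLp (fun x => f x - u₀) 2 unitMeasure := hfm.sub (memLp_const u₀)
  set g : L2 := hgm.toLp _ with hg
  have hgae : ∀ᵐ x ∂unitMeasure, g x = f x - u₀ := hgm.coeFn_toLp
  have hgint : ∫ t in (0 : ℝ)..1, g t = 0 := by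
    rw [← integral_unitMeasure, integral_congr_ae hgae,
      integral_sub (hfm.integrable (by norm_num)) (integrable_const _)]
    simp [hu₀]
  -- The test function is the primitive of `g = f - u₀`. As `g` has mean zero, it vanishes at `0`
  -- and `1` and is admissible for every `U`.
  have hg0 : g = 0 := by
    have h1 := hform (W.ofDeriv 0 g)
    rw [hy _ ((mem_HU_iff hU).2 ⟨fun _ => by simp [W.val_ofDeriv],
      fun _ => by rw [W.val_ofDeriv, hgint, add_zero]⟩), W.val_ofDeriv, W.val_ofDeriv, hgint] at h1
    simp only [intervalIntegral.integral_same, add_zero, map_zero, mul_zero, W.deriv_ofDeriv] at h1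
    have h2 : inner ℂ g g = 0 := by
      rw [L2.inner_def]
      have h3 : ∫ x, u₀ * conj (g x) ∂unitMeasure = 0 := by
        rw [integral_const_mul, integral_conj, integral_unitMeasure, hgint]
        simp
      have i3 : Integrable (fun x => u₀ * conj (g x)) unitMeasure :=
        (g.memLp_conj.integrable (by norm_num)).const_mul _
      have i4 : Integrable (fun x => f x * conj (g x)) unitMeasure :=
        hfm.integrable_mul g.memLp_conj
      calc _ = ∫ x, (f x * conj (g x) - u₀ * conj (g x)) ∂unitMeasure := by
            refine integral_congr_ae ?_
            filter_upwards [hgae] with x hx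
            rw [RCLike.inner_apply, ← sub_mul, ← hx]
        _ = 0 := by rw [integral_sub i4 i3, ← h1, h3, sub_zero]
    exact inner_self_eq_zero.1 h2
  have hfu : ∀ᵐ x ∂unitMeasure, f x = u₀ := by
    filter_upwards [hgae, Lp.coeFn_zero ℂ 2 unitMeasure] with x h1 h2
    rw [hg0, h2] at h1
    exact (sub_eq_zero.1 h1.symm)
  have hform' : ∀ z : W, d.form y z = u₀ * (conj (z.val 1) - conj (z.val 0)) +
      B 1 * conj (z.val 1) + d.v₀ * (y.val 0 * conj (z.val 0)) +
        d.v₁ * (y.val 1 * conj (z.val 1)) := fun z => by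
    rw [hform, ← map_sub, z.val_sub_val zero_mem_unit one_mem_unit, ← integral_unitMeasure,
      ← integral_conj, ← integral_const_mul]
    congr 3
    refine integral_congr_ae ?_
    filter_upwards [hfu] with x hx
    rw [hx]
  have hone : ∀ c : ℂ, ∫ t in (0 : ℝ)..1, ((memLp_const c).toLp _ : L2) t = c := fun c => by
    rw [← integral_unitMeasure, integral_congr_ae (memLp_const c).coeFn_toLp]
    simp
  refine ⟨fun x => u₀ + B x, ⟨?_, fun x _ => ?_⟩, ?_, ?_⟩
  · filter_upwards [hfu] with x hx
    rw [← hx]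
    simp only [hf]
    ring
  · simp [hB]
  · refine or_iff_not_imp_left.2 fun h => ?_
    -- The test function `1 - x` isolates the endpoint `0`.
    have h1 := hform' (W.ofDeriv 1 ((memLp_const (-1 : ℂ)).toLp _))
    have h2 : (W.ofDeriv 1 ((memLp_const (-1 : ℂ)).toLp _)).val 1 = 0 := by
      rw [W.val_ofDeriv, hone]; ring
    have h3 : (W.ofDeriv 1 ((memLp_const (-1 : ℂ)).toLp _)).val 0 = 1 := by
      rw [W.val_zero_eq, W.initial_ofDeriv]
    rw [hy _ ((mem_HU_iff hU).2 ⟨fun h' => absurd h' h, fun _ => h2⟩), h2, h3] at h1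
    simp only [map_zero, map_one] at h1
    simp only [hB, intervalIntegral.integral_same, add_zero]
    linear_combination h1
  · refine or_iff_not_imp_left.2 fun h => ?_
    -- The test function `x` isolates the endpoint `1`.
    have h1 := hform' (W.ofDeriv 0 ((memLp_const (1 : ℂ)).toLp _))
    have h2 : (W.ofDeriv 0 ((memLp_const (1 : ℂ)).toLp _)).val 1 = 1 := by
      rw [W.val_ofDeriv, hone]; ring
    have h3 : (W.ofDeriv 0 ((memLp_const (1 : ℂ)).toLp _)).val 0 = 0 := by
      rw [W.val_zero_eq, W.initial_ofDeriv]
    rw [hy _ ((mem_HU_iff hU).2 ⟨fun _ => h3, fun h' => absurd h' h⟩), h2, h3] at h1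
    simp only [map_zero, map_one] at h1
    linear_combination -h1

end SturmData

/-! Uniqueness for the Cauchy problem. -/

theorem ae_restrict_uIoc {P : ℝ → Prop} (h : ∀ᵐ x ∂unitMeasure, P x) {x y : ℝ}
    (hx : x ∈ Icc (0 : ℝ) 1) (hy : y ∈ Icc (0 : ℝ) 1) :
    ∀ᵐ t ∂volume.restrict (uIoc x y), P t :=
  (ae_restrict_iff' measurableSet_uIoc).2 (ae_uIoc h hx hy)

theorem norm_integral_le_abs_integral {F : Type*} [NormedAddCommGroup F] [NormedSpace ℝ F]
    {f : ℝ → F} {g : ℝ → ℝ} (hg : Integrable g unitMeasure) {x y : ℝ} (hx : x ∈ Icc (0 : ℝ) 1)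
    (hy : y ∈ Icc (0 : ℝ) 1) (h : ∀ᵐ t ∂unitMeasure, t ∈ uIoc x y → ‖f t‖ ≤ g t) :
    ‖∫ t in x..y, f t‖ ≤ |∫ t in x..y, g t| := by
  refine intervalIntegral.norm_integral_le_abs_of_norm_le ?_
    (intervalIntegrable_of_integrable hg hx hy)
  filter_upwards [ae_restrict_uIoc h hx hy, ae_restrict_mem measurableSet_uIoc] with t h1 h2
    using h1 h2

/-- Absolute continuity of the integral at a point. -/
theorem exists_abs_integral_lt {k : ℝ → ℝ} (hk : Integrable k unitMeasure) {x₀ : ℝ}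
    (hx₀ : x₀ ∈ Icc (0 : ℝ) 1) {e : ℝ} (he : 0 < e) :
    ∃ δ > 0, ∀ x ∈ Icc (0 : ℝ) 1, |x - x₀| < δ → |∫ t in x₀..x, k t| < e := by
  obtain ⟨δ, hδ, h⟩ := Metric.continuousWithinAt_iff.1
    (continuousOn_primitive_of_integrable hk x₀ hx₀) e he
  refine ⟨δ, hδ, fun x hx hxx => ?_⟩
  have h1 := h hx (by rwa [Real.dist_eq])
  rwa [Real.dist_eq, intervalIntegral.integral_interval_sub_left
    (intervalIntegrable_of_integrable hk zero_mem_unit hx)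
    (intervalIntegrable_of_integrable hk zero_mem_unit hx₀)] at h1

theorem abs_sub_le_of_mem_uIcc {x₀ x t : ℝ} (ht : t ∈ uIcc x₀ x) : |t - x₀| ≤ |x - x₀| :=
  abs_sub_left_of_mem_uIcc ht

/-- A Grönwall-type uniqueness statement by connectedness: the zero set of `φ` is closed, and it is
open because near a zero the integral of `|k|` is below `1/2`, so that the local maximum satisfies
`φ m ≤ φ m / 2`. -/
theorem eq_zero_of_le_integral {φ k : ℝ → ℝ} (hφ : ContinuousOn φ (Icc 0 1))
    (hφ0 : ∀ x ∈ Icc (0 : ℝ) 1, 0 ≤ φ x) (hk : Integrable k unitMeasure)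
    (h : ∀ x₀ ∈ Icc (0 : ℝ) 1, ∀ x ∈ Icc (0 : ℝ) 1, φ x₀ = 0 → φ x ≤ |∫ t in x₀..x, k t * φ t|)
    {x₀ : ℝ} (hx₀ : x₀ ∈ Icc (0 : ℝ) 1) (h0 : φ x₀ = 0) : ∀ x ∈ Icc (0 : ℝ) 1, φ x = 0 := by
  have hc : Continuous fun x : Icc (0 : ℝ) 1 => φ x := hφ.domRestrict
  have hcl : IsClopen {x : Icc (0 : ℝ) 1 | φ x = 0} := by
    refine ⟨isClosed_eq hc continuous_const, ?_⟩
    refine Metric.isOpen_iff.2 fun a ha => ?_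
    obtain ⟨δ, hδ, hsmall⟩ := exists_abs_integral_lt hk.norm a.2 (half_pos one_pos)
    refine ⟨δ, hδ, fun x hx => ?_⟩
    have hsub : uIcc (a : ℝ) x ⊆ Icc 0 1 := uIcc_subset_Icc a.2 x.2
    obtain ⟨m, hm, hmax⟩ := isCompact_uIcc.exists_isMaxOn (nonempty_uIcc (a := (a : ℝ)) (b := x))
      (hφ.mono hsub)
    have hxm : φ x ≤ φ m := hmax right_mem_uIcc
    have hdist : |(x : ℝ) - a| < δ := by rw [← Real.dist_eq]; exact hx
    have h1 := h a a.2 m (hsub hm) ha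
    have h2 : ‖∫ t in (a : ℝ)..m, k t * φ t‖ ≤ |∫ t in (a : ℝ)..m, ‖k t‖ * φ m| := by
      refine norm_integral_le_abs_integral (hk.norm.mul_const _) a.2 (hsub hm) ?_
      filter_upwards with t ht
      have ht' : t ∈ uIcc (a : ℝ) x :=
        uIcc_subset_uIcc left_mem_uIcc hm (uIoc_subset_uIcc ht)
      rw [norm_mul, Real.norm_of_nonneg (hφ0 t (hsub ht'))]
      exact mul_le_mul_of_nonneg_left (hmax ht') (norm_nonneg _)
    rw [intervalIntegral.integral_mul_const, abs_mul, abs_of_nonneg (hφ0 m (hsub hm))] at h2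
    have h3 := hsmall m (hsub hm) ((abs_sub_le_of_mem_uIcc hm).trans_lt hdist)
    have h4 := hφ0 m (hsub hm)
    have h5 : φ m = 0 := by
      rw [Real.norm_eq_abs] at h2
      nlinarith
    exact le_antisymm (hxm.trans h5.le) (hφ0 x x.2)
  have huniv := hcl.eq_univ ⟨⟨x₀, hx₀⟩, h0⟩
  intro x hx
  have : (⟨x, hx⟩ : Icc (0 : ℝ) 1) ∈ {x : Icc (0 : ℝ) 1 | φ x = 0} := huniv ▸ mem_univ _
  exact this

namespace SturmData.IsSolution

variable {d : SturmData} {y : W} {u : ℝ → ℂ}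

theorem continuousOn (h : d.IsSolution y u) : ContinuousOn u (Icc 0 1) :=
  (continuousOn_const.add (continuousOn_primitive_of_integrable (d.integrable_rate y))).congr
    h.eq_add_integral

theorem sub_eq_integral (h : d.IsSolution y u) {x₀ x : ℝ} (hx₀ : x₀ ∈ Icc (0 : ℝ) 1)
    (hx : x ∈ Icc (0 : ℝ) 1) : u x - u x₀ = ∫ t in x₀..x, d.rate y t := by
  rw [h.eq_add_integral x hx, h.eq_add_integral x₀ hx₀, add_sub_add_left_eq_sub,
    intervalIntegral.integral_interval_sub_left
    (intervalIntegrable_of_integrable (d.integrable_rate y) zero_mem_unit hx)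
    (intervalIntegrable_of_integrable (d.integrable_rate y) zero_mem_unit hx₀)]

theorem deriv_eq (h : d.IsSolution y u) :
    ∀ᵐ x ∂unitMeasure, y.deriv x = (u x - d.a x * y.val x) / d.p x := by
  filter_upwards [h.ae_eq, d.lower_le] with x h1 h2
  have h3 : (d.p x : ℂ) ≠ 0 := by
    exact_mod_cast (d.lower_pos.trans_le h2).ne'
  rw [eq_div_iff h3, h1]
  ring

theorem norm_deriv_le (h : d.IsSolution y u) :
    ∀ᵐ x ∂unitMeasure, ‖y.deriv x‖ ≤ (‖u x‖ + |d.a x| * ‖y.val x‖) / d.lower := by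
  filter_upwards [h.deriv_eq, d.lower_le] with x h1 h2
  rw [h1, norm_div, Complex.norm_real, Real.norm_of_nonneg (d.lower_pos.le.trans h2)]
  have h3 : ‖u x - d.a x * y.val x‖ ≤ ‖u x‖ + |d.a x| * ‖y.val x‖ := by
    refine (norm_sub_le _ _).trans_eq ?_
    rw [norm_mul, Complex.norm_real, Real.norm_eq_abs]
  exact div_le_div₀ (by positivity) h3 d.lower_pos h2

/-- Since `y' = (u - a y) / p` and `u' = a y' + b y`, the sum `|y'| + |u'|` is at most `k (|y| +
|u|)` with `k = (1 + |a|)² / lower + |b|`. This `k` is integrable because `a` is square integrable,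
so `eq_zero_of_le_integral` applies to `|y| + |u|`. -/
theorem val_eq_zero (h : d.IsSolution y u) {x₀ : ℝ} (hx₀ : x₀ ∈ Icc (0 : ℝ) 1)
    (hy : y.val x₀ = 0) (hu : u x₀ = 0) : ∀ x ∈ Icc (0 : ℝ) 1, y.val x = 0 := by
  set k : ℝ → ℝ := fun x => (1 + |d.a x|) ^ 2 / d.lower + |d.b x| with hk
  have hki : Integrable k unitMeasure := by
    have h1 : MemLp (fun x => 1 + |d.a x|) 2 unitMeasure :=
      (memLp_const (1 : ℝ)).add d.memLp_a.abs
    exact (h1.integrable_sq.div_const _).add (d.memLp_b.integrable (by norm_num)).abs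
  set φ : ℝ → ℝ := fun x => ‖y.val x‖ + ‖u x‖ with hφ
  have hφc : ContinuousOn φ (Icc 0 1) := y.continuousOn_val.norm.add h.continuousOn.norm
  have hφ0 : ∀ x, 0 ≤ φ x := fun x => by positivity
  have hkφ : Integrable (fun x => k x * φ x) unitMeasure := by
    obtain ⟨C, hC⟩ := isCompact_Icc.exists_bound_of_continuousOn hφc
    refine hki.mul_bdd (c := C) (hφc.aestronglyMeasurable measurableSet_Icc) ?_
    filter_upwards [ae_mem] with x hx using hC x hx
  have hbound : ∀ᵐ x ∂unitMeasure, ‖y.deriv x‖ + ‖d.rate y x‖ ≤ k x * φ x := by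
    filter_upwards [h.norm_deriv_le] with x h1
    have h2 : ‖d.rate y x‖ ≤ |d.a x| * ‖y.deriv x‖ + |d.b x| * ‖y.val x‖ := by
      refine (norm_add_le _ _).trans_eq ?_
      rw [norm_mul, norm_mul, Complex.norm_real, Complex.norm_real, Real.norm_eq_abs,
        Real.norm_eq_abs]
    have h3 : ‖y.deriv x‖ ≤ (1 + |d.a x|) * φ x / d.lower := by
      refine h1.trans (div_le_div_of_nonneg_right ?_ d.lower_pos.le)
      simp only [hφ]
      nlinarith [norm_nonneg (u x), norm_nonneg (y.val x), abs_nonneg (d.a x)]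
    have h4 : |d.b x| * ‖y.val x‖ ≤ |d.b x| * φ x :=
      mul_le_mul_of_nonneg_left (le_add_of_nonneg_right (norm_nonneg _)) (abs_nonneg _)
    have h5 : (1 + |d.a x|) * ‖y.deriv x‖ ≤ (1 + |d.a x|) * ((1 + |d.a x|) * φ x / d.lower) :=
      mul_le_mul_of_nonneg_left h3 (by positivity)
    have h6 : k x * φ x = (1 + |d.a x|) * ((1 + |d.a x|) * φ x / d.lower) + |d.b x| * φ x := by
      simp only [hk]; ring
    rw [h6]
    linarith
  have hsum : ∀ x₁ ∈ Icc (0 : ℝ) 1, ∀ x ∈ Icc (0 : ℝ) 1, φ x₁ = 0 →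
      φ x ≤ |∫ t in x₁..x, k t * φ t| := fun x₁ hx₁ x hx h1 => by
    have h2 : y.val x₁ = 0 := by
      rw [← norm_eq_zero]; linarith [hφ0 x₁, norm_nonneg (y.val x₁), norm_nonneg (u x₁), h1]
    have h3 : u x₁ = 0 := by
      rw [← norm_eq_zero]; linarith [hφ0 x₁, norm_nonneg (y.val x₁), norm_nonneg (u x₁), h1]
    have h4 : ‖y.val x‖ ≤ |∫ t in x₁..x, ‖y.deriv t‖| := by
      have := y.val_sub_val hx₁ hx
      rw [h2, sub_zero] at this
      rw [this]
      exact intervalIntegral.norm_integral_le_abs_integral_norm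
    have h5 : ‖u x‖ ≤ |∫ t in x₁..x, ‖d.rate y t‖| := by
      have := h.sub_eq_integral hx₁ hx
      rw [h3, sub_zero] at this
      rw [this]
      exact intervalIntegral.norm_integral_le_abs_integral_norm
    have i1 := intervalIntegrable_of_integrable y.deriv.integrable.norm hx₁ hx
    have i2 := intervalIntegrable_of_integrable (d.integrable_rate y).norm hx₁ hx
    have h6 : |∫ t in x₁..x, ‖y.deriv t‖| + |∫ t in x₁..x, ‖d.rate y t‖| =
        |∫ t in x₁..x, (‖y.deriv t‖ + ‖d.rate y t‖)| := by
      rw [intervalIntegral.integral_add i1 i2]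
      rcases le_total x₁ x with hle | hle
      · exact (abs_add_eq_add_abs_iff _ _).2 (Or.inl
          ⟨intervalIntegral.integral_nonneg hle fun _ _ => norm_nonneg _,
            intervalIntegral.integral_nonneg hle fun _ _ => norm_nonneg _⟩) |>.symm
      · rw [intervalIntegral.integral_symm x x₁, intervalIntegral.integral_symm x x₁]
        refine (abs_add_eq_add_abs_iff _ _).2 (Or.inr ⟨?_, ?_⟩) |>.symm
        · exact neg_nonpos.2 (intervalIntegral.integral_nonneg hle fun _ _ => norm_nonneg _)
        · exact neg_nonpos.2 (intervalIntegral.integral_nonneg hle fun _ _ => norm_nonneg _)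
    have h7 : ‖∫ t in x₁..x, (‖y.deriv t‖ + ‖d.rate y t‖)‖ ≤ |∫ t in x₁..x, k t * φ t| := by
      refine norm_integral_le_abs_integral hkφ hx₁ hx ?_
      filter_upwards [hbound] with t ht _
      rwa [Real.norm_of_nonneg (by positivity)]
    rw [Real.norm_eq_abs] at h7
    change ‖y.val x‖ + ‖u x‖ ≤ _
    linarith
  intro x hx
  have := eq_zero_of_le_integral hφc (fun x _ => hφ0 x) hki hsum hx₀ (by simp [hφ, hy, hu]) x hx
  rw [← norm_eq_zero]
  linarith [hφ0 x, norm_nonneg (y.val x), norm_nonneg (u x), this]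

/-- A solution that vanishes on an interval vanishes identically. -/
theorem val_eq_zero_of_Icc (h : d.IsSolution y u) {α β : ℝ} (hαβ : α < β)
    (hα : α ∈ Icc (0 : ℝ) 1) (hβ : β ∈ Icc (0 : ℝ) 1) (hy : ∀ x ∈ Icc α β, y.val x = 0) :
    ∀ x ∈ Icc (0 : ℝ) 1, y.val x = 0 := by
  have hsub : Icc α β ⊆ Icc 0 1 := Icc_subset_Icc hα.1 hβ.2
  -- With `y = y' = 0` almost everywhere on the interval, `u` vanishes there too, everywhere by
  -- continuity, and the Cauchy data at `α` are zero.
  have hd : ∀ᵐ x ∂volume.restrict (Icc α β), y.deriv x = 0 := by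
    have h1 := (y.deriv.intervalIntegrable hα hβ).ae_hasDerivAt_integral
    rw [Measure.restrict_congr_set Ioo_ae_eq_Icc.symm]
    filter_upwards [ae_restrict_of_ae h1, ae_restrict_mem measurableSet_Ioo] with x h2 hx
    have h3 := h2 (by rw [uIcc_of_le hαβ.le]; exact Ioo_subset_Icc_self hx) α left_mem_uIcc
    refine h3.unique ((hasDerivAt_const x (0 : ℂ)).congr_of_eventuallyEq ?_)
    filter_upwards [Icc_mem_nhds hx.1 hx.2] with t ht
    rw [← y.val_sub_val hα (hsub ht), hy t ht, hy α (left_mem_Icc.2 hαβ.le), sub_zero]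
  have hu : ∀ᵐ x ∂volume.restrict (Icc α β), u x = 0 := by
    filter_upwards [hd, ae_restrict_of_ae_restrict_of_subset hsub h.ae_eq,
      ae_restrict_mem measurableSet_Icc] with x h1 h2 hx
    rw [h2, h1, hy x hx]
    ring
  have hu' := Measure.eqOn_Icc_of_ae_eq volume hαβ.ne hu (h.continuousOn.mono hsub)
    continuousOn_const
  exact h.val_eq_zero hα (hy α (left_mem_Icc.2 hαβ.le)) (hu' (left_mem_Icc.2 hαβ.le))

end SturmData.IsSolution

/-! The lower bound: cutting an eigenfunction off at its zeros. -/

/-- Evaluation at a point of `[0,1]`. -/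
def W.eval {x : ℝ} (hx : x ∈ Icc (0 : ℝ) 1) : W →ₗ[ℂ] ℂ where
  toFun w := w.val x
  map_add' w z := W.val_add w z hx
  map_smul' a w := W.val_smul a w hx

theorem W.val_sum_smul {ι : Type*} (s : Finset ι) (a : ι → ℂ) (v : ι → W) {x : ℝ}
    (hx : x ∈ Icc (0 : ℝ) 1) : (∑ i ∈ s, a i • v i).val x = ∑ i ∈ s, a i * (v i).val x := by
  have h := map_sum (W.eval hx) (fun i => a i • v i) s
  simp only [map_smul, smul_eq_mul] at h
  exact h

/-- The function that agrees with `y` on `[0, c]` and is constant on `[c, 1]`. -/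
def W.cutoff (y : W) (c : ℝ) : W :=
  W.ofDeriv y.initial (((Lp.memLp y.deriv).indicator (measurableSet_Iic (a := c))).toLp _)

theorem W.deriv_cutoff_ae (y : W) (c : ℝ) :
    ∀ᵐ x ∂unitMeasure, (y.cutoff c).deriv x = (Iic c).indicator y.deriv x :=
  ((Lp.memLp y.deriv).indicator (measurableSet_Iic (a := c))).coeFn_toLp

theorem W.val_cutoff_of_le (y : W) {c x : ℝ} (hx : x ∈ Icc (0 : ℝ) 1) (hxc : x ≤ c) :
    (y.cutoff c).val x = y.val x := by
  rw [W.val, W.val, W.cutoff, W.initial_ofDeriv]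
  congr 1
  refine intervalIntegral.integral_congr_ae ?_
  filter_upwards [ae_uIoc (y.deriv_cutoff_ae c) zero_mem_unit hx] with t ht htx
  refine (ht htx).trans (indicator_of_mem ?_ _)
  rw [uIoc_of_le hx.1] at htx
  exact htx.2.trans hxc

theorem W.val_cutoff_of_ge (y : W) {c x : ℝ} (hc : c ∈ Icc (0 : ℝ) 1) (hx : x ∈ Icc (0 : ℝ) 1)
    (hxc : c ≤ x) : (y.cutoff c).val x = y.val c := by
  rw [← y.val_cutoff_of_le hc le_rfl, ← sub_eq_zero, W.val_sub_val _ hc hx]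
  refine intervalIntegral.integral_zero_ae ?_
  filter_upwards [ae_uIoc (y.deriv_cutoff_ae c) hc hx] with t ht htx
  refine (ht htx).trans (indicator_of_notMem ?_ _)
  rw [uIoc_of_le hxc] at htx
  exact not_le.2 htx.1

namespace SturmData

variable {d : SturmData}

/-- The second argument is supported in `[0, c]`, where the first one still coincides with `y`, and
it kills the boundary term at `1`. For `y` in the kernel this is what makes the cut-off functions
isotropic. -/
theorem form_cutoff_cutoff {y : W} {c e : ℝ} (hc : c ∈ Ioo (0 : ℝ) 1) (he : e ∈ Ioo (0 : ℝ) 1)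
    (hyc : y.val c = 0) (hce : c ≤ e) :
    d.form (y.cutoff e) (y.cutoff c) = d.form y (y.cutoff c) := by
  have hc' := Ioo_subset_Icc_self hc
  have h1 : (y.cutoff c).val 1 = 0 := by
    rw [y.val_cutoff_of_ge hc' one_mem_unit hc.2.le, hyc]
  have h2 : (y.cutoff e).val 0 = y.val 0 := y.val_cutoff_of_le zero_mem_unit he.1.le
  have h3 : ∫ x, d.density (y.cutoff e) (y.cutoff c) x ∂unitMeasure =
      ∫ x, d.density y (y.cutoff c) x ∂unitMeasure := by
    refine integral_congr_ae ?_
    filter_upwards [ae_mem, y.deriv_cutoff_ae c, y.deriv_cutoff_ae e] with x hx h4 h5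
    rcases le_or_gt x c with hxc | hxc
    · have hxe : x ∈ Iic e := hxc.trans hce
      simp only [density, h5, y.val_cutoff_of_le hx (hxc.trans hce), indicator_of_mem hxe]
    · have hxc' : x ∉ Iic c := not_le.2 hxc
      simp only [density, h4, y.val_cutoff_of_ge hc' hx hxc.le, hyc, indicator_of_notMem hxc',
        map_zero, mul_zero, add_zero]
  rw [form, form, h1, h2, h3]
  simp

/-- On either side of `c`, closer than any other point of `S`, there are points where `y ≠ 0`,
because `y` vanishes on no interval. The two sums over the points of `S` to the right of them differ
exactly by `a c`. -/
theorem IsSolution.coeff_eq_zero {y : W} {u : ℝ → ℂ} (h : d.IsSolution y u) (hy : y ≠ 0)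
    {S : Finset ℝ} (hS : ∀ c ∈ S, c ∈ Ioo (0 : ℝ) 1 ∧ y.val c = 0) {a : ℝ → ℂ}
    (ha : ∀ x ∈ Icc (0 : ℝ) 1, y.val x ≠ 0 → ∑ c ∈ S with x ≤ c, a c = 0) {c : ℝ} (hc : c ∈ S) :
    a c = 0 := by
  have hne : ∀ α β : ℝ, α < β → α ∈ Icc (0 : ℝ) 1 → β ∈ Icc (0 : ℝ) 1 →
      ∃ x ∈ Icc α β, y.val x ≠ 0 := fun α β hαβ hα hβ => by
    by_contra! hcon
    refine hy (W.ext_val fun x hx => ?_)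
    rw [h.val_eq_zero_of_Icc hαβ hα hβ hcon x hx]
    have := W.val_smul 0 y hx
    rw [zero_smul, zero_mul] at this
    exact this.symm
  have hn : ((↑(S.erase c) : Set ℝ)ᶜ ∩ Ioo 0 1) ∈ nhds c :=
    Filter.inter_mem ((S.erase c).finite_toSet.isClosed.isOpen_compl.mem_nhds (by simp))
      (Ioo_mem_nhds (hS c hc).1.1 (hS c hc).1.2)
  obtain ⟨e, he, hsub⟩ := Metric.nhds_basis_closedBall.mem_iff.1 hn
  rw [Real.closedBall_eq_Icc] at hsub
  have hunit : ∀ x ∈ Icc (c - e) (c + e), x ∈ Icc (0 : ℝ) 1 := fun x hx =>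
    Ioo_subset_Icc_self (hsub hx).2
  have hiso : ∀ x ∈ Icc (c - e) (c + e), x ∈ S → x = c := fun x hx hxS => by
    by_contra hxc
    exact (hsub hx).1 (by simp [hxc, hxS])
  have hcm : c ∈ Icc (c - e) (c + e) := ⟨by linarith, by linarith⟩
  have hlm : c - e ∈ Icc (c - e) (c + e) := ⟨le_rfl, by linarith⟩
  have hrm : c + e ∈ Icc (c - e) (c + e) := ⟨by linarith, le_rfl⟩
  obtain ⟨x, hx, hxy⟩ := hne (c - e) c (by linarith) (hunit _ hlm) (hunit _ hcm)
  obtain ⟨z, hz, hzy⟩ := hne c (c + e) (by linarith) (hunit _ hcm) (hunit _ hrm)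
  have hxc : x < c := lt_of_le_of_ne hx.2 fun hxc => hxy (hxc ▸ (hS c hc).2)
  have hzc : c < z := lt_of_le_of_ne hz.1 fun hzc => hzy (hzc ▸ (hS c hc).2)
  have hx' : x ∈ Icc (c - e) (c + e) := ⟨hx.1, hx.2.trans hcm.2⟩
  have hz' : z ∈ Icc (c - e) (c + e) := ⟨hcm.1.trans hz.1, hz.2⟩
  have h1 := ha x (hunit x hx') hxy
  have h2 := ha z (hunit z hz') hzy
  have h3 : (S.filter fun t => x ≤ t) = insert c (S.filter fun t => z ≤ t) := by
    ext t
    simp only [Finset.mem_filter, Finset.mem_insert]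
    constructor
    · rintro ⟨ht, hxt⟩
      by_cases htz : t ≤ z
      · exact Or.inl (hiso t ⟨hx'.1.trans hxt, htz.trans hz'.2⟩ ht)
      · exact Or.inr ⟨ht, (not_le.1 htz).le⟩
    · rintro (rfl | ⟨ht, hzt⟩)
      · exact ⟨hc, hxc.le⟩
      · exact ⟨ht, (hxc.trans hzc).le.trans hzt⟩
  rw [h3, Finset.sum_insert (by simp [hzc]), h2, add_zero] at h1
  exact h1

end SturmData

/-! ### The index is at least the number of zeros. -/

variable {p : Lp ℝ ∞ unitMeasure} {q r : WNeg} {U : Matrix (Fin 2) (Fin 2) ℂ} {lam : ℝ}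
  {d : SturmData}

theorem inner_plusPencil_symm (hd : ∀ y z : W, form p q r U (lam : ℂ) y z = d.form y z)
    (y z : HU U) :
    inner ℂ (plusPencil p q r U lam y) z = inner ℂ y (plusPencil p q r U lam z) := by
  rw [← inner_conj_symm, inner_plusPencil, inner_plusPencil, hd, hd, ← d.form_conj]

theorem form_eq_zero_of_plusPencil (hd : ∀ y z : W, form p q r U (lam : ℂ) y z = d.form y z)
    {y : HU U} (hy : plusPencil p q r U lam y = 0) : ∀ z ∈ HU U, d.form y z = 0 := fun z hz => by
  rw [← hd, ← inner_plusPencil p q r U lam y ⟨z, hz⟩, hy, inner_zero_right]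

/-- The number of zeros of an eigenfunction is at most the index of inertia. -/
theorem card_zeros_le_operatorIndex (hdiag : U.IsDiag)
    (hd : ∀ y z : W, form p q r U (lam : ℂ) y z = d.form y z) {y : HU U} (hy0 : y ≠ 0)
    (hy : plusPencil p q r U lam y = 0) {S : Finset ℝ}
    (hS : ∀ c ∈ S, c ∈ Ioo (0 : ℝ) 1 ∧ (y : W).val c = 0) :
    (S.card : ℕ∞) ≤ operatorIndex (plusPencil p q r U lam) := by
  have hker := form_eq_zero_of_plusPencil hd hy
  obtain ⟨u, hu, -, -⟩ := d.exists_isSolution hdiag hker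
  have hmem : ∀ c ∈ S, (y : W).cutoff c ∈ HU U := fun c hc => by
    refine (mem_HU_iff hdiag).2 ⟨fun h0 => ?_, fun _ => ?_⟩
    · rw [W.val_cutoff_of_le _ zero_mem_unit (hS c hc).1.1.le]
      exact ((mem_HU_iff hdiag).1 y.2).1 h0
    · rw [W.val_cutoff_of_ge _ (Ioo_subset_Icc_self (hS c hc).1) one_mem_unit (hS c hc).1.2.le,
        (hS c hc).2]
  let v : S → HU U := fun c => ⟨(y : W).cutoff c, hmem c c.2⟩
  have hle : ∀ c e : S, (c : ℝ) ≤ e → d.form (v e) (v c) = 0 := fun c e hce => by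
    change d.form ((y : W).cutoff e) ((y : W).cutoff c) = 0
    rw [SturmData.form_cutoff_cutoff (hS c c.2).1 (hS e e.2).1 (hS c c.2).2 hce]
    exact hker _ (hmem c c.2)
  have hiso : ∀ c e : S, inner ℂ (v c) (plusPencil p q r U lam (v e)) = 0 := fun c e => by
    rw [inner_plusPencil, hd]
    rcases le_total (c : ℝ) e with h | h
    · exact hle c e h
    · rw [d.form_conj, hle e c h, map_zero]
  rw [← Fintype.card_coe]
  refine card_le_operatorIndex _ (inner_plusPencil_symm hd) v hiso fun a ha => ?_
  -- A combination killed by the operator is itself a solution, so unique continuation applies to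
  -- it.
  obtain ⟨u', hu', -, -⟩ := d.exists_isSolution hdiag (form_eq_zero_of_plusPencil hd ha)
  have hval : ∀ x ∈ Icc (0 : ℝ) 1, ((∑ c, a c • v c : HU U) : W).val x =
      ∑ c : S, a c * ((y : W).cutoff c).val x := fun x hx => by
    rw [← W.val_sum_smul _ _ _ hx]
    congr 1
    simp [v]
  let a' : ℝ → ℂ := fun t => if ht : t ∈ S then a ⟨t, ht⟩ else 0
  have ha' : ∀ c : S, a' c = a c := fun c => by simp [a']
  have hval' : ∀ x ∈ Icc (0 : ℝ) 1, ((∑ c, a c • v c : HU U) : W).val x =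
      (∑ c ∈ S with x ≤ c, a' c) * (y : W).val x := fun x hx => by
    rw [hval x hx, Finset.sum_filter, Finset.sum_mul, ← Finset.sum_coe_sort S]
    refine Finset.sum_congr rfl fun c _ => ?_
    split_ifs with hxc
    · rw [W.val_cutoff_of_le _ hx hxc, ha']
    · rw [W.val_cutoff_of_ge _ (Ioo_subset_Icc_self (hS c c.2).1) hx (not_le.1 hxc).le,
        (hS c c.2).2]
      simp
  rcases S.eq_empty_or_nonempty with rfl | hne
  · exact Subsingleton.elim _ _
  have hmax := (hS _ (S.max'_mem hne)).1
  -- To the right of the largest zero all cut-off functions vanish, hence so does the combination,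
  -- and then it vanishes on all of `[0, 1]`.
  have hzero := hu'.val_eq_zero_of_Icc hmax.2 (Ioo_subset_Icc_self hmax) one_mem_unit
    fun x hx => by
      have hx' : x ∈ Icc (0 : ℝ) 1 := ⟨hmax.1.le.trans hx.1, hx.2⟩
      rw [hval x hx']
      refine Finset.sum_eq_zero fun c _ => ?_
      rw [W.val_cutoff_of_ge _ (Ioo_subset_Icc_self (hS c c.2).1) hx'
        ((S.le_max' _ c.2).trans hx.1), (hS c c.2).2, mul_zero]
  funext c
  rw [← ha']
  refine hu.coeff_eq_zero (fun h => hy0 (Subtype.ext h)) hS (fun x hx hxy => ?_) c.2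
  have := hzero x hx
  rw [hval' x hx] at this
  exact (mul_eq_zero.1 this).resolve_right hxy

/-! Absolutely continuous functions. -/

theorem absolutelyContinuousOnInterval_of_dist_le {X Y : Type*} [PseudoMetricSpace X]
    [PseudoMetricSpace Y] {f : ℝ → X} {g : ℝ → Y} {α β K : ℝ}
    (hg : AbsolutelyContinuousOnInterval g α β)
    (h : ∀ x ∈ uIcc α β, ∀ y ∈ uIcc α β, dist (f x) (f y) ≤ K * dist (g x) (g y)) :
    AbsolutelyContinuousOnInterval f α β := by
  have hK := Filter.Tendsto.const_mul K hg
  rw [mul_zero] at hK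
  refine squeeze_zero' (Filter.Eventually.of_forall fun t =>
    Finset.sum_nonneg fun _ _ => dist_nonneg) ?_ hK
  refine Filter.eventually_inf_principal.2 (Filter.Eventually.of_forall fun t ht => ?_)
  rw [Finset.mul_sum]
  exact Finset.sum_le_sum fun i hi => h _ (ht.1 i hi).1 _ (ht.1 i hi).2

theorem absolutelyContinuousOnInterval_of_integral {F : Type*} [NormedAddCommGroup F]
    [NormedSpace ℝ F] {f g : ℝ → F} (hg : Integrable g unitMeasure)
    (h : ∀ x ∈ Icc (0 : ℝ) 1, ∀ y ∈ Icc (0 : ℝ) 1, f y - f x = ∫ t in x..y, g t) :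
    AbsolutelyContinuousOnInterval f 0 1 := by
  have h1 := (intervalIntegrable_of_integrable hg.norm zero_mem_unit
    one_mem_unit).absolutelyContinuousOnInterval_intervalIntegral left_mem_uIcc
  refine absolutelyContinuousOnInterval_of_dist_le (K := 1) h1 fun x hx y hy => ?_
  rw [uIcc_of_le zero_le_one] at hx hy
  rw [one_mul, dist_comm, dist_eq_norm, h x hx y hy, dist_comm, Real.dist_eq,
    intervalIntegral.integral_interval_sub_left
      (intervalIntegrable_of_integrable hg.norm zero_mem_unit hy)
      (intervalIntegrable_of_integrable hg.norm zero_mem_unit hx)]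
  exact intervalIntegral.norm_integral_le_abs_integral_norm

theorem AbsolutelyContinuousOnInterval.inv_complex {f : ℝ → ℂ} {α β : ℝ}
    (hf : AbsolutelyContinuousOnInterval f α β) (h : ∀ x ∈ uIcc α β, f x ≠ 0) :
    AbsolutelyContinuousOnInterval (fun x => (f x)⁻¹) α β := by
  obtain ⟨C, hC⟩ := isCompact_uIcc.exists_bound_of_continuousOn (hf.continuousOn.inv₀ h)
  refine absolutelyContinuousOnInterval_of_dist_le (K := C * C) hf fun x hx y hy => ?_
  rw [dist_eq_norm, inv_sub_inv (h x hx) (h y hy), div_eq_mul_inv, mul_inv, norm_mul, norm_mul,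
    mul_comm, ← dist_eq_norm, dist_comm]
  have hx' := hC x hx
  have hy' := hC y hy
  simp only [Pi.inv_apply] at hx' hy'
  exact mul_le_mul_of_nonneg_right
    (mul_le_mul hx' hy' (norm_nonneg _) ((norm_nonneg _).trans hx')) dist_nonneg

theorem AbsolutelyContinuousOnInterval.conj_complex {f : ℝ → ℂ} {α β : ℝ}
    (hf : AbsolutelyContinuousOnInterval f α β) :
    AbsolutelyContinuousOnInterval (fun x => conj (f x)) α β :=
  absolutelyContinuousOnInterval_of_dist_le (K := 1) hf fun x _ y _ => by
    rw [Complex.dist_conj_conj, one_mul]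

theorem AbsolutelyContinuousOnInterval.re_complex {f : ℝ → ℂ} {α β : ℝ}
    (hf : AbsolutelyContinuousOnInterval f α β) :
    AbsolutelyContinuousOnInterval (fun x => (f x).re) α β :=
  absolutelyContinuousOnInterval_of_dist_le (K := 1) hf fun x _ y _ => by
    rw [Real.dist_eq, one_mul, dist_eq_norm, ← Complex.sub_re]
    exact Complex.abs_re_le_norm _

theorem AbsolutelyContinuousOnInterval.im_complex {f : ℝ → ℂ} {α β : ℝ}
    (hf : AbsolutelyContinuousOnInterval f α β) :
    AbsolutelyContinuousOnInterval (fun x => (f x).im) α β :=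
  absolutelyContinuousOnInterval_of_dist_le (K := 1) hf fun x _ y _ => by
    rw [Real.dist_eq, one_mul, dist_eq_norm, ← Complex.sub_im]
    exact Complex.abs_im_le_norm _

theorem W.absolutelyContinuousOnInterval_val (w : W) :
    AbsolutelyContinuousOnInterval w.val 0 1 :=
  absolutelyContinuousOnInterval_of_integral w.deriv.integrable fun _ hx _ hy =>
    w.val_sub_val hx hy

theorem ae_mem_Ioo : ∀ᵐ x ∂unitMeasure, x ∈ Ioo (0 : ℝ) 1 := by
  rw [unitMeasure, Measure.restrict_congr_set Ioo_ae_eq_Icc.symm]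
  exact ae_restrict_mem measurableSet_Ioo

theorem ae_hasDerivAt_of_integral {f g : ℝ → ℂ} (hg : Integrable g unitMeasure)
    (h : ∀ x ∈ Icc (0 : ℝ) 1, ∀ y ∈ Icc (0 : ℝ) 1, f y - f x = ∫ t in x..y, g t) :
    ∀ᵐ x ∂unitMeasure, HasDerivAt f (g x) x := by
  have h1 := (intervalIntegrable_of_integrable hg zero_mem_unit
    one_mem_unit).ae_hasDerivAt_integral
  filter_upwards [ae_mem_Ioo, ae_restrict_of_ae h1] with x hx h2
  have h3 := h2 (by rw [uIcc_of_le zero_le_one]; exact Ioo_subset_Icc_self hx) 0 left_mem_uIcc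
  refine (h3.const_add (f 0)).congr_of_eventuallyEq ?_
  filter_upwards [Icc_mem_nhds hx.1 hx.2] with t ht
  rw [← h 0 zero_mem_unit t ht]
  ring

theorem W.ae_hasDerivAt (w : W) : ∀ᵐ x ∂unitMeasure, HasDerivAt w.val (w.deriv x) x :=
  ae_hasDerivAt_of_integral w.deriv.integrable fun _ hx _ hy => w.val_sub_val hx hy

theorem hasDerivAt_re {f : ℝ → ℂ} {f' : ℂ} {x : ℝ} (h : HasDerivAt f f' x) :
    HasDerivAt (fun t => (f t).re) f'.re x :=
  Complex.reCLM.hasFDerivAt.comp_hasDerivAt x h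

theorem hasDerivAt_im {f : ℝ → ℂ} {f' : ℂ} {x : ℝ} (h : HasDerivAt f f' x) :
    HasDerivAt (fun t => (f t).im) f'.im x :=
  Complex.imCLM.hasFDerivAt.comp_hasDerivAt x h

theorem hasDerivAt_conj {f : ℝ → ℂ} {f' : ℂ} {x : ℝ} (h : HasDerivAt f f' x) :
    HasDerivAt (fun t => conj (f t)) (conj f') x :=
  h.star

/-! Picone's identity. -/

namespace SturmData.IsSolution

variable {d : SturmData} {y : W} {u : ℝ → ℂ}

theorem absolutelyContinuousOnInterval (h : d.IsSolution y u) :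
    AbsolutelyContinuousOnInterval u 0 1 :=
  absolutelyContinuousOnInterval_of_integral (d.integrable_rate y) fun _ hx _ hy =>
    h.sub_eq_integral hx hy

theorem ae_hasDerivAt (h : d.IsSolution y u) :
    ∀ᵐ x ∂unitMeasure, HasDerivAt u (d.rate y x) x :=
  ae_hasDerivAt_of_integral (d.integrable_rate y) fun _ hx _ hy => h.sub_eq_integral hx hy

/-- The derivative of `u ȳ` is `p |y'|² + 2 a Re (y' ȳ) + b |y|²`, which is real, so the imaginary
part is constant. This lets a complex eigenfunction be handled like a real one. -/
theorem im_mul_conj (h : d.IsSolution y u) (h0 : (u 0 * conj (y.val 0)).im = 0) {x : ℝ}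
    (hx : x ∈ Icc (0 : ℝ) 1) : (u x * conj (y.val x)).im = 0 := by
  have hac : AbsolutelyContinuousOnInterval (fun t => (u t * conj (y.val t)).im) 0 1 :=
    AbsolutelyContinuousOnInterval.im_complex (h.absolutelyContinuousOnInterval.fun_smul
      (AbsolutelyContinuousOnInterval.conj_complex y.absolutelyContinuousOnInterval_val))
  have hd : ∀ᵐ t, t ∈ uIcc (0 : ℝ) 1 →
      HasDerivAt (fun t => (u t * conj (y.val t)).im) 0 t := by
    rw [uIcc_of_le zero_le_one]
    refine (ae_restrict_iff' measurableSet_Icc).1 ?_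
    filter_upwards [h.ae_hasDerivAt, y.ae_hasDerivAt, h.ae_eq] with t h1 h2 h3
    have h4 : HasDerivAt (fun t => (u t * conj (y.val t)).im) _ t :=
      hasDerivAt_im (h1.mul (hasDerivAt_conj h2))
    convert h4 using 1
    rw [h3, rate]
    simp only [Complex.add_im, Complex.mul_im, Complex.add_re, Complex.mul_re, Complex.conj_re,
      Complex.conj_im, Complex.ofReal_re, Complex.ofReal_im]
    ring
  obtain ⟨C, hC⟩ := hac.const_of_ae_hasDerivAt_zero hd
  rw [uIcc_of_le zero_le_one] at hC
  rw [hC x hx, ← hC 0 zero_mem_unit, h0]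

/-- The boundary function `(u / y) |z|²` of Picone's identity (it vanishes at the zeros of `y`). -/
def picone (y z : W) (u : ℝ → ℂ) (x : ℝ) : ℝ := (u x / y.val x * (z.val x * conj (z.val x))).re

/-- As `a` is real, `Im (u ȳ) = p Im (y' ȳ)`, so `y' = g y` with `g` real. The right side minus the
left side is then `p |z' - g z|²`. -/
theorem picone_algebra {p a b : ℝ} (hp : 0 ≤ p) (hp0 : p ≠ 0) {y y' z z' u : ℂ} (hy : y ≠ 0)
    (hu : u = p * y' + a * y) (him : (u * conj y).im = 0) :
    (((a * y' + b * y) * y - u * y') / y ^ 2 * (z * conj z) +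
        u / y * (z' * conj z + z * conj z')).re ≤
      (p * z' * conj z' + a * (z' * conj z + z * conj z') + b * (z * conj z)).re := by
  obtain ⟨g, hg⟩ : ∃ g : ℝ, y' = g * y := by
    have h1 : (y' * conj y).im = 0 := by
      have h2 : (u * conj y).im = p * (y' * conj y).im := by
        rw [hu]
        simp only [Complex.add_im, Complex.mul_im, Complex.add_re, Complex.mul_re, Complex.conj_re,
          Complex.conj_im, Complex.ofReal_re, Complex.ofReal_im]
        ring
      rw [h2] at him
      exact (mul_eq_zero.1 him).resolve_left hp0
    refine ⟨(y' * conj y).re / Complex.normSq y, ?_⟩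
    have h3 : y' * conj y = ((y' * conj y).re : ℂ) := Complex.ext (by simp) (by simp [h1])
    have h4 : (Complex.normSq y : ℂ) ≠ 0 := by
      exact_mod_cast (Complex.normSq_pos.2 hy).ne'
    rw [Complex.ofReal_div, ← h3, div_mul_eq_mul_div, eq_div_iff h4, Complex.normSq_eq_conj_mul_self]
    ring
  have h5 : ((a * y' + b * y) * y - u * y') / y ^ 2 * (z * conj z) +
        u / y * (z' * conj z + z * conj z') =
      ((b - p * g ^ 2 : ℝ) : ℂ) * (z * conj z) +
        ((p * g + a : ℝ) : ℂ) * (z' * conj z + z * conj z') := by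
    rw [hu, hg]
    push_cast
    field_simp
    ring
  rw [h5, ← sub_nonneg, ← Complex.sub_re]
  have h6 : (p * z' * conj z' + a * (z' * conj z + z * conj z') + b * (z * conj z) -
      (((b - p * g ^ 2 : ℝ) : ℂ) * (z * conj z) +
        ((p * g + a : ℝ) : ℂ) * (z' * conj z + z * conj z'))).re =
      p * ((z'.re - g * z.re) ^ 2 + (z'.im - g * z.im) ^ 2) := by
    simp only [Complex.add_im, Complex.mul_im, Complex.add_re, Complex.mul_re, Complex.conj_re,
      Complex.conj_im, Complex.ofReal_re, Complex.ofReal_im, Complex.sub_re]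
    ring
  rw [h6]
  positivity

/-- Away from the zeros of `y` the function `(u / y) |z|²` is absolutely continuous, so the
pointwise inequality `picone_algebra` can be integrated. -/
theorem picone_sub_le (h : d.IsSolution y u)
    (him : ∀ x ∈ Icc (0 : ℝ) 1, (u x * conj (y.val x)).im = 0) (z : W) {α β : ℝ} (hαβ : α ≤ β)
    (hα : α ∈ Icc (0 : ℝ) 1) (hβ : β ∈ Icc (0 : ℝ) 1) (hy : ∀ x ∈ Icc α β, y.val x ≠ 0) :
    picone y z u β - picone y z u α ≤ ∫ x in α..β, (d.density z z x).re := by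
  have hsub : uIcc α β ⊆ uIcc 0 1 := uIcc_subset_uIcc (by rwa [uIcc_of_le zero_le_one])
    (by rwa [uIcc_of_le zero_le_one])
  have hac : AbsolutelyContinuousOnInterval (picone y z u) α β := by
    have h1 := AbsolutelyContinuousOnInterval.inv_complex
      (y.absolutelyContinuousOnInterval_val.mono hsub) (by rwa [uIcc_of_le hαβ])
    have h2 := z.absolutelyContinuousOnInterval_val.mono hsub
    exact AbsolutelyContinuousOnInterval.re_complex
      (((h.absolutelyContinuousOnInterval.mono hsub).fun_smul h1).fun_smul
        (h2.fun_smul (AbsolutelyContinuousOnInterval.conj_complex h2)))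
  rw [← hac.integral_deriv_eq_sub]
  refine intervalIntegral.integral_mono_ae_restrict hαβ hac.intervalIntegrable_deriv
    (intervalIntegrable_of_integrable (d.integrable_density z z).re hα hβ) ?_
  have hsub' : Icc α β ⊆ Icc 0 1 := Icc_subset_Icc hα.1 hβ.2
  filter_upwards [ae_restrict_mem measurableSet_Icc,
    ae_restrict_of_ae_restrict_of_subset hsub' h.ae_hasDerivAt,
    ae_restrict_of_ae_restrict_of_subset hsub' y.ae_hasDerivAt,
    ae_restrict_of_ae_restrict_of_subset hsub' z.ae_hasDerivAt,
    ae_restrict_of_ae_restrict_of_subset hsub' h.ae_eq,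
    ae_restrict_of_ae_restrict_of_subset hsub' d.lower_le] with x hx h1 h2 h3 h4 h5
  have h6 : HasDerivAt (picone y z u) _ x :=
    hasDerivAt_re ((h1.div h2 (hy x hx)).mul (h3.mul (hasDerivAt_conj h3)))
  rw [h6.deriv]
  have hp := d.lower_pos.trans_le h5
  exact picone_algebra hp.le hp.ne' (hy x hx) h4 (him x (hsub' hx))

end SturmData.IsSolution

/-! Behaviour of a solution at its zeros. -/

/-- By continuity the inequality extends to intervals whose endpoints are exceptional; finitely many
such intervals are then chained. -/
theorem le_of_finite_exceptions {G : ℝ → ℝ} (hG : ContinuousOn G (Icc 0 1)) {S : Set ℝ}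
    (hS : S.Finite) (h : ∀ α ∈ Icc (0 : ℝ) 1, ∀ β ∈ Icc (0 : ℝ) 1, α ≤ β →
      (∀ x ∈ Icc α β, x ∉ S) → G α ≤ G β) : G 0 ≤ G 1 := by
  have h1 : ∀ α ∈ Icc (0 : ℝ) 1, ∀ β ∈ Icc (0 : ℝ) 1, α < β → (∀ x ∈ Ioo α β, x ∉ S) →
      G α ≤ G β := fun α hα β hβ hαβ hx => by
    have hsub : Icc α β ⊆ Icc 0 1 := Icc_subset_Icc hα.1 hβ.2
    obtain ⟨m, hm⟩ := exists_between hαβ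
    have ha : G α ≤ G m := by
      have : (nhdsWithin α (Ioo α m)).NeBot := left_nhdsWithin_Ioo_neBot hm.1
      have hs : Ioo α m ⊆ Icc 0 1 := fun t ht => hsub ⟨ht.1.le, (ht.2.trans hm.2).le⟩
      refine le_of_tendsto ((hG α hα).mono_left (nhdsWithin_mono _ hs)) ?_
      filter_upwards [self_mem_nhdsWithin] with t ht
      exact h t (hsub ⟨ht.1.le, (ht.2.trans hm.2).le⟩) m (hsub ⟨hm.1.le, hm.2.le⟩) ht.2.le
        fun x hx' => hx x ⟨ht.1.trans_le hx'.1, hx'.2.trans_lt hm.2⟩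
    have hb : G m ≤ G β := by
      have : (nhdsWithin β (Ioo m β)).NeBot := right_nhdsWithin_Ioo_neBot hm.2
      have hs : Ioo m β ⊆ Icc 0 1 := fun t ht => hsub ⟨(hm.1.trans ht.1).le, ht.2.le⟩
      refine ge_of_tendsto ((hG β hβ).mono_left (nhdsWithin_mono _ hs)) ?_
      filter_upwards [self_mem_nhdsWithin] with t ht
      exact h m (hsub ⟨hm.1.le, hm.2.le⟩) t (hsub ⟨(hm.1.trans ht.1).le, ht.2.le⟩) ht.1.le
        fun x hx' => hx x ⟨hm.1.trans_le hx'.1, hx'.2.trans_lt ht.2⟩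
    exact ha.trans hb
  -- Induction on a finite set containing the exceptional points inside `(α, β)`: the interval is
  -- split at the inserted point when that point lies in it.
  have h2 : ∀ T : Finset ℝ, ∀ α ∈ Icc (0 : ℝ) 1, ∀ β ∈ Icc (0 : ℝ) 1, α ≤ β →
      (∀ x ∈ Ioo α β, x ∈ S → x ∈ T) → G α ≤ G β := fun T => by
    induction T using Finset.induction_on with
    | empty =>
      intro α hα β hβ hαβ hx
      rcases hαβ.eq_or_lt with rfl | hlt
      · exact le_rfl
      · exact h1 α hα β hβ hlt fun x hx' hxS => by simpa using hx x hx' hxS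
    | insert c T _ ih =>
      intro α hα β hβ hαβ hx
      by_cases hc : c ∈ Ioo α β
      · have hc' : c ∈ Icc (0 : ℝ) 1 := ⟨hα.1.trans hc.1.le, hc.2.le.trans hβ.2⟩
        refine (ih α hα c hc' hc.1.le fun x hx' hxS => ?_).trans
          (ih c hc' β hβ hc.2.le fun x hx' hxS => ?_)
        · exact (Finset.mem_insert.1 (hx x ⟨hx'.1, hx'.2.trans hc.2⟩ hxS)).resolve_left hx'.2.ne
        · exact (Finset.mem_insert.1 (hx x ⟨hc.1.trans hx'.1, hx'.2⟩ hxS)).resolve_left hx'.1.ne'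
      · refine ih α hα β hβ hαβ fun x hx' hxS => ?_
        exact (Finset.mem_insert.1 (hx x hx' hxS)).resolve_left fun hxc => hc (hxc ▸ hx')
  exact h2 hS.toFinset 0 zero_mem_unit 1 one_mem_unit zero_le_one
    fun x _ hxS => hS.mem_toFinset.2 hxS

theorem integrableOn_uIoc {f : ℝ → ℝ} (hf : Integrable f unitMeasure) {x y : ℝ}
    (hx : x ∈ Icc (0 : ℝ) 1) (hy : y ∈ Icc (0 : ℝ) 1) :
    Integrable f (volume.restrict (uIoc x y)) :=
  intervalIntegrable_iff.1 (intervalIntegrable_of_integrable hf hx hy)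

theorem abs_integral_eq_setIntegral_uIoc {f : ℝ → ℝ} (hf : ∀ x, 0 ≤ f x) (x y : ℝ) :
    |∫ t in x..y, f t| = ∫ t in uIoc x y, f t := by
  rw [intervalIntegral.abs_integral_eq_abs_integral_uIoc, abs_of_nonneg (integral_nonneg hf)]

theorem isFiniteMeasure_restrict_uIoc (x y : ℝ) : IsFiniteMeasure (volume.restrict (uIoc x y)) :=
  inferInstanceAs (IsFiniteMeasure (volume.restrict (Ioc _ _)))

theorem measureReal_uIoc (x y : ℝ) : (volume.restrict (uIoc x y)).real univ = |y - x| := by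
  rw [measureReal_restrict_apply_univ, measureReal_def, uIoc, Real.volume_Ioc,
    ENNReal.toReal_ofReal (by simp), max_sub_min_eq_abs]

/-- The Cauchy–Schwarz inequality for increments. -/
theorem W.norm_sub_sq_le (w : W) {x₀ x : ℝ} (hx₀ : x₀ ∈ Icc (0 : ℝ) 1)
    (hx : x ∈ Icc (0 : ℝ) 1) :
    ‖w.val x - w.val x₀‖ ^ 2 ≤ |x - x₀| * |∫ t in x₀..x, ‖w.deriv t‖ ^ 2| := by
  have i1 := integrableOn_uIoc w.deriv.integrable.norm hx₀ hx
  have i2 : Integrable (fun t => ‖w.deriv t‖ ^ 2) (volume.restrict (uIoc x₀ x)) :=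
    integrableOn_uIoc (Lp.memLp w.deriv).integrable_norm_pow' hx₀ hx
  have hfin := isFiniteMeasure_restrict_uIoc x₀ x
  set ν := volume.restrict (uIoc x₀ x)
  set N := ∫ t, ‖w.deriv t‖ ∂ν with hN
  set J := ∫ t, ‖w.deriv t‖ ^ 2 ∂ν with hJ
  have h1 : ‖w.val x - w.val x₀‖ ≤ N := by
    rw [w.val_sub_val hx₀ hx]
    exact intervalIntegral.norm_integral_le_integral_norm_uIoc
  rw [abs_integral_eq_setIntegral_uIoc (fun _ => by positivity)]
  -- The integral of `(|w'| - s)²` is nonnegative for every `s`; the choice `s = N / |x - x₀|` gives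
  -- `N² ≤ |x - x₀| J`.
  have h2 : ∀ s : ℝ, 0 ≤ J - 2 * s * N + s ^ 2 * |x - x₀| := fun s => by
    have h3 : ∫ t, (‖w.deriv t‖ - s) ^ 2 ∂ν = J - 2 * s * N + s ^ 2 * |x - x₀| := by
      have h4 : ∀ t, (‖w.deriv t‖ - s) ^ 2 = ‖w.deriv t‖ ^ 2 - 2 * s * ‖w.deriv t‖ + s ^ 2 :=
        fun t => by ring
      simp only [h4]
      have i3 : Integrable (fun t => ‖w.deriv t‖ ^ 2 - 2 * s * ‖w.deriv t‖) ν :=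
        i2.sub (i1.const_mul _)
      rw [integral_add i3 (integrable_const _),
        integral_sub i2 (i1.const_mul _), integral_const_mul, integral_const, measureReal_uIoc,
        smul_eq_mul]
      ring
    rw [← h3]
    exact integral_nonneg fun t => by positivity
  have hN0 : 0 ≤ N := (norm_nonneg _).trans h1
  refine (pow_le_pow_left₀ (norm_nonneg _) h1 2).trans ?_
  rcases (abs_nonneg (x - x₀)).eq_or_lt with h0 | h0
  · have hxx : x = x₀ := sub_eq_zero.1 (abs_eq_zero.1 h0.symm)
    have : N = 0 := by simp [hN, ν, hxx]
    rw [this, ← h0]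
    simp
  · have h3 := h2 (N / |x - x₀|)
    have h4 : (J - 2 * (N / |x - x₀|) * N + (N / |x - x₀|) ^ 2 * |x - x₀|) * |x - x₀| =
        |x - x₀| * J - N ^ 2 := by
      field_simp
      ring
    have h5 := mul_nonneg h3 h0.le
    rw [h4] at h5
    linarith

namespace SturmData.IsSolution

variable {d : SturmData} {y : W} {u : ℝ → ℂ}

/-- A nontrivial solution grows at least linearly at its zeros. -/
theorem exists_linear_le (h : d.IsSolution y u) {x₀ : ℝ} (hx₀ : x₀ ∈ Icc (0 : ℝ) 1)
    (hy : y.val x₀ = 0) (hu : u x₀ ≠ 0) :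
    ∃ κ > 0, ∃ δ > 0, ∀ x ∈ Icc (0 : ℝ) 1, |x - x₀| < δ → κ * |x - x₀| ≤ ‖y.val x‖ := by
  have hl := d.lower_pos
  have hup := d.upper_pos
  set n : ℝ := ‖u x₀‖ with hn
  have hn0 : 0 < n := norm_pos_iff.2 hu
  -- In `y' = (u - a y) / p` the term `a y` may be unbounded, but near `x₀` the integral of `|a|` is
  -- below `e * lower`. The value `1/2` lets it be absorbed in the upper bound `hA`; `lower / (16
  -- upper)` makes it at most half of the main term in `hB`.
  set e : ℝ := min (1 / 2) (d.lower / (16 * d.upper)) with he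
  have he0 : 0 < e := by positivity
  have he1 : e ≤ 1 / 2 := min_le_left _ _
  have he2 : e * (16 * d.upper) ≤ d.lower := (le_div_iff₀ (by positivity)).1 (min_le_right _ _)
  have hai : Integrable (fun x => |d.a x|) unitMeasure :=
    (d.memLp_a.integrable (by norm_num)).abs
  obtain ⟨δ₁, hδ₁, h1⟩ := exists_abs_integral_lt hai hx₀ (mul_pos he0 hl)
  obtain ⟨δ₂, hδ₂, h2⟩ := Metric.continuousWithinAt_iff.1 (h.continuousOn x₀ hx₀) (n / 2)
    (by positivity)
  refine ⟨n / (4 * d.upper), by positivity, min δ₁ δ₂, lt_min hδ₁ hδ₂, fun x hx hxd => ?_⟩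
  have hsub : uIcc x₀ x ⊆ Icc 0 1 := uIcc_subset_Icc hx₀ hx
  have hclose : ∀ t ∈ uIcc x₀ x, ‖u t - u x₀‖ ≤ n / 2 := fun t ht => by
    rw [← dist_eq_norm]
    refine (h2 (hsub ht) ?_).le
    rw [Real.dist_eq]
    exact (abs_sub_le_of_mem_uIcc ht).trans_lt (hxd.trans_le (min_le_right _ _))
  have hle : ∀ t ∈ uIcc x₀ x, ‖u t‖ ≤ 2 * n := fun t ht => by
    have := norm_add_le (u t - u x₀) (u x₀)
    rw [sub_add_cancel] at this
    linarith [hclose t ht]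
  have hsmall : ∀ t ∈ uIcc x₀ x, |(∫ s in x₀..t, |d.a s|)| ≤ e * d.lower := fun t ht =>
    (h1 t (hsub ht) ((abs_sub_le_of_mem_uIcc ht).trans_lt (hxd.trans_le (min_le_left _ _)))).le
  obtain ⟨m, hm, hmax⟩ := isCompact_uIcc.exists_isMaxOn (nonempty_uIcc (a := x₀) (b := x))
    (y.continuousOn_val.norm.mono hsub)
  set M : ℝ := ‖y.val m‖ with hM
  have hM0 : 0 ≤ M := norm_nonneg _
  have hmax' : ∀ t ∈ uIcc x₀ x, ‖y.val t‖ ≤ M := fun t ht => hmax ht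
  -- Integrating `|y'| ≤ (2n + |a| M) / lower` up to the maximum point gives `M ≤ 2n |x - x₀| /
  -- lower + M / 2`.
  have hA : M ≤ 4 * n / d.lower * |x - x₀| := by
    have h3 : ‖∫ t in x₀..m, y.deriv t‖ ≤ |∫ t in x₀..m, (2 * n + |d.a t| * M) / d.lower| := by
      refine norm_integral_le_abs_integral
        (((integrable_const _).add (hai.mul_const _)).div_const _) hx₀ (hsub hm) ?_
      filter_upwards [h.norm_deriv_le] with t ht htm
      have ht' : t ∈ uIcc x₀ x := uIcc_subset_uIcc left_mem_uIcc hm (uIoc_subset_uIcc htm)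
      refine ht.trans (div_le_div_of_nonneg_right ?_ hl.le)
      exact add_le_add (hle t ht') (mul_le_mul_of_nonneg_left (hmax' t ht') (abs_nonneg _))
    rw [← y.val_sub_val hx₀ (hsub hm), hy, sub_zero, intervalIntegral.integral_div,
      intervalIntegral.integral_add intervalIntegrable_const
        (intervalIntegrable_of_integrable (hai.mul_const _) hx₀ (hsub hm)),
      intervalIntegral.integral_const, intervalIntegral.integral_mul_const, abs_div,
      abs_of_pos hl, le_div_iff₀ hl, smul_eq_mul] at h3
    have h4 := abs_add_le ((m - x₀) * (2 * n)) ((∫ t in x₀..m, |d.a t|) * M)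
    rw [abs_mul _ (2 * n), abs_mul _ M, abs_of_pos (by positivity : 0 < 2 * n),
      abs_of_nonneg hM0] at h4
    have h5 : |m - x₀| * (2 * n) ≤ |x - x₀| * (2 * n) :=
      mul_le_mul_of_nonneg_right (abs_sub_le_of_mem_uIcc hm) (by positivity)
    have h6 : |(∫ t in x₀..m, |d.a t|)| * M ≤ 1 / 2 * d.lower * M :=
      mul_le_mul_of_nonneg_right ((hsmall m hm).trans
        (mul_le_mul_of_nonneg_right he1 hl.le)) hM0
    rw [div_mul_eq_mul_div, le_div_iff₀ hl]
    linarith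
  -- Projecting `y'` on the direction of `u x₀` prevents cancellation: near `x₀` the real part of
  -- `conj (u x₀) * u` is at least `n² / 2`.
  have hB : n ^ 2 / (2 * d.upper) * |x - x₀| - n * M / d.lower * (e * d.lower) ≤
      n * ‖y.val x‖ := by
    set f : ℝ → ℝ := fun t => (conj (u x₀) * y.deriv t).re with hf
    have hfi : Integrable f unitMeasure := (y.deriv.integrable.const_mul (conj (u x₀))).re
    have h3 : (conj (u x₀) * y.val x).re = ∫ t in x₀..x, f t := by
      have h4 := y.val_sub_val hx₀ hx
      rw [hy, sub_zero] at h4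
      rw [h4, ← intervalIntegral.integral_const_mul]
      exact (Complex.reCLM.intervalIntegral_comp_comm
        ((y.deriv.intervalIntegrable hx₀ hx).const_mul (conj (u x₀)))).symm
    have h5 : |(conj (u x₀) * y.val x).re| ≤ n * ‖y.val x‖ := by
      refine (Complex.abs_re_le_norm _).trans_eq ?_
      rw [norm_mul, RCLike.norm_conj]
    have h6 : ∫ t in uIoc x₀ x, (n ^ 2 / (2 * d.upper) - n * M / d.lower * |d.a t|) ≤
        ∫ t in uIoc x₀ x, f t := by
      refine integral_mono_ae
        (integrableOn_uIoc ((integrable_const _).sub (hai.const_mul _)) hx₀ hx)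
        (integrableOn_uIoc hfi hx₀ hx) ?_
      filter_upwards [ae_restrict_uIoc h.deriv_eq hx₀ hx, ae_restrict_uIoc d.lower_le hx₀ hx,
        ae_restrict_uIoc d.le_upper hx₀ hx, ae_restrict_mem measurableSet_uIoc]
        with t h7 h8 h9 ht
      have ht' := uIoc_subset_uIcc ht
      have hp := hl.trans_le h8
      have h10 : f t = ((conj (u x₀) * u t).re - d.a t * (conj (u x₀) * y.val t).re) / d.p t := by
        simp only [hf]
        rw [h7, mul_div_assoc', Complex.div_ofReal_re, mul_sub, Complex.sub_re,
          mul_left_comm, Complex.re_ofReal_mul]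
      have h11 : n ^ 2 / 2 ≤ (conj (u x₀) * u t).re := by
        have h12 : (conj (u x₀) * u t).re = n ^ 2 + (conj (u x₀) * (u t - u x₀)).re := by
          rw [mul_sub, Complex.sub_re, Complex.conj_mul', ← hn]
          norm_cast
          ring
        have h13 := (abs_le.1 (Complex.abs_re_le_norm (conj (u x₀) * (u t - u x₀)))).1
        rw [norm_mul, RCLike.norm_conj, ← hn] at h13
        nlinarith [hclose t ht']
      have h14 : d.a t * (conj (u x₀) * y.val t).re ≤ |d.a t| * (n * M) := by
        refine (le_abs_self _).trans ?_
        rw [abs_mul]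
        refine mul_le_mul_of_nonneg_left ((Complex.abs_re_le_norm _).trans ?_) (abs_nonneg _)
        rw [norm_mul, RCLike.norm_conj]
        exact mul_le_mul_of_nonneg_left (hmax' t ht') hn0.le
      have h15 : n ^ 2 / (2 * d.upper) ≤ (n ^ 2 / 2) / d.p t := by
        rw [← div_div]
        exact div_le_div_of_nonneg_left (by positivity) hp h9
      have h16 : |d.a t| * (n * M) / d.p t ≤ |d.a t| * (n * M) / d.lower :=
        div_le_div_of_nonneg_left (by positivity) hl h8
      rw [h10, sub_div]
      have h17 := div_le_div_of_nonneg_right h11 hp.le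
      have h18 := div_le_div_of_nonneg_right h14 hp.le
      have h19 : n * M / d.lower * |d.a t| = |d.a t| * (n * M) / d.lower := by ring
      rw [h19]
      linarith
    have hfin := isFiniteMeasure_restrict_uIoc x₀ x
    rw [integral_sub (integrable_const _) ((integrableOn_uIoc hai hx₀ hx).const_mul _),
      integral_const_mul, integral_const, measureReal_uIoc, smul_eq_mul,
      ← abs_integral_eq_setIntegral_uIoc (fun _ => abs_nonneg _)] at h6
    have h20 : n * M / d.lower * |(∫ t in x₀..x, |d.a t|)| ≤ n * M / d.lower * (e * d.lower) :=
      mul_le_mul_of_nonneg_left (hsmall x right_mem_uIcc) (by positivity)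
    have h21 : ∫ t in uIoc x₀ x, f t ≤ |∫ t in x₀..x, f t| := by
      rw [intervalIntegral.abs_integral_eq_abs_integral_uIoc]
      exact le_abs_self _
    rw [← h3] at h21
    linarith
  have hC : n * M / d.lower * (e * d.lower) ≤ n * (n / (4 * d.upper) * |x - x₀|) := by
    have h3 : n * M / d.lower * (e * d.lower) = n * (M * e) := by field_simp
    rw [h3]
    refine mul_le_mul_of_nonneg_left ?_ hn0.le
    have h4 : M * e ≤ 4 * n / d.lower * |x - x₀| * e := mul_le_mul_of_nonneg_right hA he0.le
    have h5 : e / d.lower ≤ 1 / (16 * d.upper) := by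
      rw [div_le_div_iff₀ hl (by positivity)]
      linarith
    calc M * e ≤ 4 * n * |x - x₀| * (e / d.lower) := h4.trans_eq (by ring)
      _ ≤ 4 * n * |x - x₀| * (1 / (16 * d.upper)) :=
        mul_le_mul_of_nonneg_left h5 (by positivity)
      _ = _ := by field_simp; ring
  have hD : n ^ 2 / (2 * d.upper) * |x - x₀| = 2 * (n * (n / (4 * d.upper) * |x - x₀|)) := by
    field_simp
    ring
  have hE : n * (n / (4 * d.upper) * |x - x₀|) ≤ n * ‖y.val x‖ := by linarith
  exact le_of_mul_le_mul_left hE hn0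

end SturmData.IsSolution

/-! The upper bound: the form is nonnegative on functions vanishing at the zeros of `y`. -/

namespace SturmData.IsSolution

variable {d : SturmData} {y : W} {u : ℝ → ℂ}

/-- At a zero `x₀` of `y`, `|y| ≥ κ |x - x₀|` while `|z|² ≤ |x - x₀| |∫ |z'|²|` over the interval
from `x₀` to `x`. So the quotient is bounded by a multiple of that integral and tends to `0`, the
value that division by zero assigns at `x₀`. -/
theorem continuousOn_picone (h : d.IsSolution y u)
    (hu : ∀ x ∈ Icc (0 : ℝ) 1, y.val x = 0 → u x ≠ 0) {z : W}
    (hz : ∀ x ∈ Icc (0 : ℝ) 1, y.val x = 0 → z.val x = 0) :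
    ContinuousOn (picone y z u) (Icc 0 1) := by
  intro x₀ hx₀
  by_cases hy : y.val x₀ = 0
  · obtain ⟨κ, hκ, δ, hδ, hlin⟩ := h.exists_linear_le hx₀ hy (hu x₀ hx₀ hy)
    obtain ⟨C, hC⟩ := isCompact_Icc.exists_bound_of_continuousOn h.continuousOn
    have hC0 : 0 ≤ C := (norm_nonneg _).trans (hC x₀ hx₀)
    have hJi : Integrable (fun t => ‖z.deriv t‖ ^ 2) unitMeasure :=
      (Lp.memLp z.deriv).integrable_norm_pow'
    have hzero : picone y z u x₀ = 0 := by simp [picone, hy]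
    rw [ContinuousWithinAt, hzero]
    have hlim : Filter.Tendsto (fun x => C / κ * |∫ t in x₀..x, ‖z.deriv t‖ ^ 2|)
        (nhdsWithin x₀ (Icc 0 1)) (nhds 0) := by
      have h1 : Filter.Tendsto (fun x => ∫ t in x₀..x, ‖z.deriv t‖ ^ 2)
          (nhdsWithin x₀ (Icc 0 1)) (nhds 0) := by
        refine Metric.tendsto_nhdsWithin_nhds.2 fun e he => ?_
        obtain ⟨η, hη, hη'⟩ := exists_abs_integral_lt hJi hx₀ he
        refine ⟨η, hη, fun x hx hxd => ?_⟩
        rw [Real.dist_eq, sub_zero]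
        exact hη' x hx (by rwa [← Real.dist_eq])
      simpa using (h1.abs).const_mul (C / κ)
    refine squeeze_zero_norm' ?_ hlim
    filter_upwards [self_mem_nhdsWithin, mem_nhdsWithin_of_mem_nhds (Metric.ball_mem_nhds x₀ hδ)]
      with x hx hxd
    rw [Metric.mem_ball, Real.dist_eq] at hxd
    have h1 := hlin x hx hxd
    have h2 := z.norm_sub_sq_le hx₀ hx
    rw [hz x₀ hx₀ hy, sub_zero] at h2
    set J := |∫ t in x₀..x, ‖z.deriv t‖ ^ 2|
    have hJ0 : 0 ≤ J := abs_nonneg _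
    have h3 : ‖picone y z u x‖ ≤ ‖u x‖ / ‖y.val x‖ * ‖z.val x‖ ^ 2 := by
      refine (Complex.abs_re_le_norm _).trans_eq ?_
      rw [norm_mul, norm_div, norm_mul, RCLike.norm_conj, sq]
    refine h3.trans ?_
    rcases eq_or_ne (y.val x) 0 with h4 | h4
    · rw [h4]
      simp only [norm_zero, div_zero, zero_mul]
      positivity
    · have h5 : 0 < ‖y.val x‖ := norm_pos_iff.2 h4
      rw [div_mul_eq_mul_div, div_mul_eq_mul_div, div_le_div_iff₀ h5 hκ]
      calc ‖u x‖ * ‖z.val x‖ ^ 2 * κ ≤ C * (|x - x₀| * J) * κ := by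
            gcongr
            exact hC x hx
        _ = C * J * (κ * |x - x₀|) := by ring
        _ ≤ C * J * ‖y.val x‖ := by gcongr
  · have hz' := z.continuousOn_val x₀ hx₀
    exact Complex.continuous_re.continuousAt.comp_continuousWithinAt
      (((h.continuousOn x₀ hx₀).div (y.continuousOn_val x₀ hx₀) hy).mul
        (hz'.mul (z.continuousOn_conj_val x₀ hx₀)))

/-- The difference `G` of the integrated density and `(u / y) |z|²` increases between zeros of `y`
and is continuous across them, so `G 0 ≤ G 1`. The boundary conditions turn the endpoint values of
`(u / y) |z|²` into `v₀ |z 0|²` and `-v₁ |z 1|²`, and the inequality becomes nonnegativity of the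
form. -/
theorem form_nonneg (h : d.IsSolution y u)
    (hu : ∀ x ∈ Icc (0 : ℝ) 1, y.val x = 0 → u x ≠ 0)
    (hfin : {x : ℝ | x ∈ Ioo (0 : ℝ) 1 ∧ y.val x = 0}.Finite) {z : W}
    (hz : ∀ x ∈ Icc (0 : ℝ) 1, y.val x = 0 → z.val x = 0)
    (h0 : z.val 0 = 0 ∨ u 0 = d.v₀ * y.val 0) (h1 : z.val 1 = 0 ∨ u 1 = -(d.v₁ * y.val 1))
    (h0' : (u 0 * conj (y.val 0)).im = 0) : 0 ≤ (d.form z z).re := by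
  have him : ∀ x ∈ Icc (0 : ℝ) 1, (u x * conj (y.val x)).im = 0 := fun x hx => h.im_mul_conj h0' hx
  have hint := (d.integrable_density z z).re
  set G : ℝ → ℝ := fun x => (∫ t in (0 : ℝ)..x, (d.density z z t).re) - picone y z u x with hG
  have hGc : ContinuousOn G (Icc 0 1) :=
    (continuousOn_primitive_of_integrable hint).sub (h.continuousOn_picone hu hz)
  have hS : {x : ℝ | x ∈ Icc (0 : ℝ) 1 ∧ y.val x = 0}.Finite := by
    refine (hfin.union (Set.toFinite {0, 1})).subset fun x hx => ?_
    rcases hx.1.1.eq_or_lt with h2 | h2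
    · exact Or.inr (Or.inl h2.symm)
    · rcases hx.1.2.eq_or_lt with h3 | h3
      · exact Or.inr (Or.inr h3)
      · exact Or.inl ⟨⟨h2, h3⟩, hx.2⟩
  have hmono := le_of_finite_exceptions hGc hS fun α hα β hβ hαβ hne => by
    have h2 := h.picone_sub_le him z hαβ hα hβ fun x hx hyx =>
      hne x hx ⟨⟨hα.1.trans hx.1, hx.2.trans hβ.2⟩, hyx⟩
    have h3 := intervalIntegral.integral_interval_sub_left
      (intervalIntegrable_of_integrable hint zero_mem_unit hβ)
      (intervalIntegrable_of_integrable hint zero_mem_unit hα)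
    simp only [hG]
    simp only [RCLike.re_to_complex] at h3
    linarith
  have hbd : ∀ x ∈ Icc (0 : ℝ) 1, ∀ v : ℝ, (z.val x = 0 ∨ u x = v * y.val x) →
      picone y z u x = (v * (z.val x * conj (z.val x))).re := fun x hx v hv => by
    rcases eq_or_ne (z.val x) 0 with h2 | h2
    · simp [picone, h2]
    · have h3 : y.val x ≠ 0 := fun h3 => h2 (hz x hx h3)
      rw [picone, hv.resolve_left h2, mul_div_cancel_right₀ _ h3]
  have hb0 := hbd 0 zero_mem_unit d.v₀ h0
  have hb1 := hbd 1 one_mem_unit (-d.v₁) (h1.imp id fun h => by rw [h]; push_cast; ring)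
  have hform : (d.form z z).re = (∫ t in (0 : ℝ)..1, (d.density z z t).re) +
      (d.v₀ * (z.val 0 * conj (z.val 0))).re + (d.v₁ * (z.val 1 * conj (z.val 1))).re := by
    rw [form, Complex.add_re, Complex.add_re, ← integral_unitMeasure]
    congr 2
    exact (integral_re (d.integrable_density z z)).symm
  have hneg : (((-d.v₁ : ℝ) : ℂ) * (z.val 1 * conj (z.val 1))).re =
      -(d.v₁ * (z.val 1 * conj (z.val 1))).re := by
    rw [Complex.re_ofReal_mul, Complex.re_ofReal_mul, neg_mul]
  simp only [hG, intervalIntegral.integral_same, zero_sub, hb0, hb1, hneg] at hmono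
  linarith

end SturmData.IsSolution

/-! ### The index equals the number of zeros. -/

variable {p : Lp ℝ ∞ unitMeasure} {q r : WNeg} {U : Matrix (Fin 2) (Fin 2) ℂ} {lam : ℝ}
  {d : SturmData}

/-- The index of inertia is at most the number of zeros of an eigenfunction. -/
theorem operatorIndex_le_encard_zeros (hdiag : U.IsDiag)
    (hd : ∀ y z : W, form p q r U (lam : ℂ) y z = d.form y z) {y : HU U} (hy0 : y ≠ 0)
    (hy : plusPencil p q r U lam y = 0) :
    operatorIndex (plusPencil p q r U lam) ≤
      {x : ℝ | x ∈ Ioo (0 : ℝ) 1 ∧ (y : W).val x = 0}.encard := by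
  set S := {x : ℝ | x ∈ Ioo (0 : ℝ) 1 ∧ (y : W).val x = 0} with hS
  rcases S.finite_or_infinite with hfin | hinf
  swap
  · rw [hinf.encard_eq]
    exact le_top
  obtain ⟨u, hu, hu0, hu1⟩ := d.exists_isSolution hdiag (form_eq_zero_of_plusPencil hd hy)
  have hyW : (y : W) ≠ 0 := fun h => hy0 (Subtype.ext h)
  have hnt : ∀ x ∈ Icc (0 : ℝ) 1, (y : W).val x = 0 → u x ≠ 0 := fun x hx h1 h2 => by
    refine hyW (W.ext_val fun t ht => ?_)
    rw [hu.val_eq_zero hx h1 h2 t ht]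
    have := W.val_smul 0 (y : W) ht
    rw [zero_smul, zero_mul] at this
    exact this.symm
  have hyU := (mem_HU_iff hdiag).1 y.2
  have him : (u 0 * conj ((y : W).val 0)).im = 0 := by
    rcases hu0 with h1 | h1
    · simp [hyU.1 h1]
    · rw [h1, mul_assoc, Complex.mul_conj, ← Complex.ofReal_mul, Complex.ofReal_im]
  have : Fintype S := hfin.fintype
  let l : HU U →ₗ[ℂ] (S → ℂ) :=
    LinearMap.pi fun c => (W.eval (Ioo_subset_Icc_self c.2.1)) ∘ₗ (HU U).subtype
  have hcard := formIndex_le_card (plusPencil p q r U (lam : ℂ)).reApplyInnerSelf l fun z hz => by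
    have hzU := (mem_HU_iff hdiag).1 z.2
    have hzS : ∀ c ∈ S, (z : W).val c = 0 := fun c hc => congrFun hz ⟨c, hc⟩
    -- Endpoint zeros of `y` cost no extra condition: the natural condition would give `u 0 = 0` as
    -- well, so `y 0 = 0` occurs only if `U 0 0 = 1`, and then `z 0 = 0` too.
    have hz0 : (y : W).val 0 = 0 → (z : W).val 0 = 0 := fun h1 => by
      rcases hu0 with h2 | h2
      · exact hzU.1 h2
      · exact absurd (by rw [h2, h1, mul_zero]) (hnt 0 zero_mem_unit h1)
    have hz1 : (y : W).val 1 = 0 → (z : W).val 1 = 0 := fun h1 => by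
      rcases hu1 with h2 | h2
      · exact hzU.2 h2
      · exact absurd (by rw [h2, h1, mul_zero, neg_zero]) (hnt 1 one_mem_unit h1)
    have hzv : ∀ x ∈ Icc (0 : ℝ) 1, (y : W).val x = 0 → (z : W).val x = 0 := fun x hx h1 => by
      rcases hx.1.eq_or_lt with rfl | h2
      · exact hz0 h1
      · rcases hx.2.eq_or_lt with rfl | h3
        · exact hz1 h1
        · exact hzS x ⟨⟨h2, h3⟩, h1⟩
    have hnn := hu.form_nonneg hnt hfin hzv (hu0.imp hzU.1 id) (hu1.imp hzU.2 id) him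
    rwa [ContinuousLinearMap.reApplyInnerSelf_apply, inner_plusPencil_symm hd, inner_plusPencil,
      hd]
  rw [← Set.coe_fintypeCard S]
  exact hcard

/-- The bound for finite sets of zeros suffices: were there infinitely many, subsets of every size
would force the index to be `⊤`. -/
theorem encard_zeros_le_operatorIndex (hdiag : U.IsDiag)
    (hd : ∀ y z : W, form p q r U (lam : ℂ) y z = d.form y z) {y : HU U} (hy0 : y ≠ 0)
    (hy : plusPencil p q r U lam y = 0) :
    {x : ℝ | x ∈ Ioo (0 : ℝ) 1 ∧ (y : W).val x = 0}.encard ≤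
      operatorIndex (plusPencil p q r U lam) := by
  set S := {x : ℝ | x ∈ Ioo (0 : ℝ) 1 ∧ (y : W).val x = 0} with hS
  have key : ∀ T : Finset ℝ, (T : Set ℝ) ⊆ S →
      (T.card : ℕ∞) ≤ operatorIndex (plusPencil p q r U lam) := fun T hT =>
    card_zeros_le_operatorIndex hdiag hd hy0 hy fun c hc => hT hc
  rcases S.finite_or_infinite with hfin | hinf
  · rw [hfin.encard_eq_coe_toFinset_card]
    exact key _ (by simp)
  · refine le_of_eq_of_le hinf.encard_eq (top_le_iff.2 (ENat.eq_top_iff_forall_ge.2 fun n => ?_))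
    obtain ⟨T, hT, hn⟩ := hinf.exists_subset_card_eq n
    rw [← hn]
    exact key T hT

end SturmLiouville

end

theorem mainTheorem4
    (p : Lp ℝ ∞ SturmLiouville.unitMeasure)
    (hp : ∃ c : ℝ, 0 < c ∧ ∀ᵐ x ∂SturmLiouville.unitMeasure, c ≤ p x)
    (q r : SturmLiouville.WNeg) (hq : q.IsReal) (hr : r.IsReal)
    (U : Matrix (Fin 2) (Fin 2) ℂ) (hU : U ∈ Matrix.unitaryGroup (Fin 2) ℂ) (hdiag : U.IsDiag)
    (lam : ℝ) (y : SturmLiouville.HU U) (hy : y ≠ 0)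
    (heigen : SturmLiouville.pencil p q r U (lam : ℂ) y = 0) :
    SturmLiouville.operatorIndex (SturmLiouville.plusPencil p q r U (lam : ℂ)) =
      {x : ℝ | x ∈ Ioo (0 : ℝ) 1 ∧ SturmLiouville.W.val (y : SturmLiouville.W) x = 0}.encard := by
  obtain ⟨d, hd⟩ := SturmLiouville.exists_sturmData p hp q r hq hr U lam
  have hker : SturmLiouville.plusPencil p q r U (lam : ℂ) y = 0 := by
    rw [SturmLiouville.plusPencil, ContinuousLinearMap.comp_apply, heigen, map_zero]
  exact le_antisymm (SturmLiouville.operatorIndex_le_encard_zeros hdiag hd hy hker)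
    (SturmLiouville.encard_zeros_le_operatorIndex hdiag hd hy hker)
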